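/- **Setting.** A (single-sorted) unbounded continuous signature $\mathcal L$ consists of function and predicate symbols with arities, a distinguished binary distance symbol $d$ and a distinguished unary gauge symbol $\nu$, and for each symbol $s$ a continuity modulus, i.e. an increasing left-continuous function $\delta_s\colon(0,\infty)\to(0,\infty)$. An $\mathcal L$-structure is a complete metric space $(M,d)$, possibly empty, with a $1$-Lipschitz gauge $\nu\colon M\to[0,\infty)$ all of whose balls $\{\nu\le r\}$ are bounded, and with interpretations $f^M\colon M^n\to M$, $P^M\colon M^n\to[0,\infty)$ such that each symbol $s$ (including $d$ and $\nu$) respects $\delta_s$ under $\nu$: for all $\varepsilon>0$, if $\nu(\bar x),\nu(\bar y)<1/\varepsilon$ and $d(\bar x,\bar y)<\delta_s(\varepsilon)$, then $d(s(\bar x),s(\bar y))\le\varepsilon$ and $\nu(s(\bar x))\le 1/\delta_s(\varepsilon)$. Here $M^n$ carries the maximum metric and the maximum gauge (which is $0$ if $n=0$), and $[0,\infty)$ carries the usual metric and the identity as gauge. A pre-structure is the same with $d$ only a pseudo-metric, not necessarily complete. Formulae are built from atomic formulae $P\bar\tau$ (including $d(\tau,\sigma)$, $\nu(\tau)$; $\tau,\sigma$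 terms) by the connectives $1$, $x/2$, $x+y$, $x\dot- y=\max(x-y,0)$, and by $\inf_x\varphi$, $\sup_x\varphi$, the latter two only when $\varphi$ is syntactically eventually constant (e.c.) in $x$. Boundedness and eventual constancy are defined inductively. No atomic formula is bounded; an atomic formula is e.c. in $x$ iff $x$ does not occur in it. A combination by a connective of formulae that are all bounded (resp. e.c. in $x$) is bounded (resp. e.c. in $x$). If $\varphi$ is bounded, then $\varphi\dot-\psi$ is bounded for every $\psi$, and $\varphi\dot-\nu(x)$ is e.c. in $x$. If $\varphi$ is bounded (resp. e.c. in $y$), so are $\inf_x\varphi$ and $\sup_x\varphi$. For $\varphi(x,\bar y)$ e.c. in $x$, the formula $\varphi(\infty,\bar y)$ is $\varphi$ if $x$ is not free in $\varphi$, is $0$ if $\varphi=\psi\dot-\nu(x)$ with $\psi$ bounded, and is obtained componentwise through connectives (all of whose arguments are e.c. in $x$) and through quantifiers over other variables. Formulae are interpreted in the natural way, quantifiers ranging over $M\cup\{\infty\}$: $(\inf_x\varphi(x,\bar a))^M=\inf_{b\in M\cup\{\infty\}}\varphi(b,\bar a)^M$, where $\varphi(\infty,\bar a)^M$ is the value of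 the formula $\varphi(\infty,\bar y)$ at $\bar a$; likewise for $\sup$. Let $(M_i)_{i\in I}$ be $\mathcal L$-structures, $\mathcal U$ an ultrafilter on $I$, and $I_0=\{i: M_i\ne\emptyset\}$. Let $N_0=\{(a_i)\in\prod_{i\in I_0}M_i:\lim_{\mathcal U}\nu^{M_i}(a_i)<\infty\}$ if $I_0\in\mathcal U$, and $N_0=\emptyset$ otherwise. Function symbols act on $N_0$ coordinatewise and predicate symbols (including $d$, $\nu$) are interpreted by $P^{N_0}((a_i),\ldots)=\lim_{\mathcal U}P^{M_i}(a_i,\ldots)$. This makes $N_0$ a pre-structure. The ultraproduct $\prod M_i/\mathcal U$ is the structure obtained from $N_0$ by dividing by the relation $d=0$, completing, and extending the symbols by continuity; $[a_i]$ denotes the image of $(a_i)\in N_0$. **Theorem (Łoś's Theorem).** Let $\varphi(x_0,\ldots,x_{n-1})$ be a formula and let $(a_{0,i}),\ldots,(a_{n-1,i})\in N_0$. Then the values of $\varphi$ in every $M_i$ (at every $n$-tuple) and the value $\varphi([a_{0,i}],\ldots,[a_{n-1,i}])^{\prod M_i/\mathcal U}$ are finite, and $$\varphi\bigl([a_{0,i}],\ldots,[a_{n-1,i}]\bigr)^{\prod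 M_i/\mathcal U}=\lim_{\mathcal U}\varphi(a_{0,i},\ldots,a_{n-1,i})^{M_i}.$$ -/

import Mathlib

open Filter Topology UniformSpace
open scoped NNReal ENNReal

universe u v w x

namespace UnboundedLogic

/-! ### Continuity moduli and uniform continuity under a gauge -/

/-- A continuity modulus: a (weakly) increasing, left-continuous function `(0,∞) → (0,∞)`.
The values of `toFun` outside `(0,∞)` play no role. -/
structure ContinuityModulus where
  toFun : ℝ → ℝ
  pos : ∀ ε, 0 < ε → 0 < toFun ε
  monotoneOn : MonotoneOn toFun (Set.Ioi 0)
  leftContinuous : ∀ ε, 0 < ε → ContinuousWithinAt toFun (Set.Iic ε) ε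

instance : CoeFun ContinuityModulus (fun _ => ℝ → ℝ) := ⟨ContinuityModulus.toFun⟩

/-- `f : (X, d, νX) → (Y, d, νY)` respects `δ` under `ν`. -/
def RespectsUnder {X : Type*} {Y : Type*} [PseudoMetricSpace X] [PseudoMetricSpace Y]
    (νX : X → ℝ≥0) (νY : Y → ℝ≥0) (δ : ContinuityModulus) (f : X → Y) : Prop :=
  ∀ ε : ℝ, 0 < ε → ∀ a b : X, (νX a : ℝ) < 1 / ε → (νX b : ℝ) < 1 / ε → dist a b < δ ε →
    dist (f a) (f b) ≤ ε ∧ (νY (f a) : ℝ) ≤ 1 / δ ε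

/-- The gauge of the finite power `Xⁿ`: the maximum of the gauges of the coordinates (`0` if
`n = 0`).  The metric of `Fin n → X` is Mathlib's maximum metric. -/
def tupleGauge {X : Type*} (ν : X → ℝ≥0) {n : ℕ} (a : Fin n → X) : ℝ≥0 :=
  Finset.univ.sup fun i => ν (a i)

/-! ### Signatures and structures -/

/-- A (single-sorted) unbounded continuous signature.  `Functions n` and `Relations n` are the
non-distinguished `n`-ary function and predicate symbols; the distance symbol and the gauge symbol
are always present, and are represented by their continuity moduli. -/
structure Signature extends FirstOrder.Language.{u, v} where
  funcModulus : ∀ {n : ℕ}, Functions n → ContinuityModulus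
  relModulus : ∀ {n : ℕ}, Relations n → ContinuityModulus
  distModulus : ContinuityModulus
  gaugeModulus : ContinuityModulus

/-- An unbounded pre-structure on a pseudo-metric space `M` (possibly empty).  A *structure* is a
pre-structure on a complete metric space, i.e. `[MetricSpace M] [CompleteSpace M]
[PreStructure S M]`. -/
class PreStructure (S : Signature.{u, v}) (M : Type w) [PseudoMetricSpace M] where
  gauge : M → ℝ≥0
  func : ∀ {n : ℕ}, S.Functions n → (Fin n → M) → M
  rel : ∀ {n : ℕ}, S.Relations n → (Fin n → M) → ℝ≥0
  gauge_lipschitz : LipschitzWith 1 gauge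
  isBounded_gaugeBall : ∀ r : ℝ≥0, Bornology.IsBounded {a : M | gauge a ≤ r}
  func_respects : ∀ {n : ℕ} (f : S.Functions n),
    RespectsUnder (tupleGauge gauge) gauge (S.funcModulus f) (func f)
  rel_respects : ∀ {n : ℕ} (R : S.Relations n),
    RespectsUnder (tupleGauge gauge) id (S.relModulus R) (rel R)
  dist_respects : RespectsUnder (tupleGauge gauge) id S.distModulus
    (fun a : Fin 2 → M => nndist (a 0) (a 1))
  gauge_respects : RespectsUnder (tupleGauge gauge) id S.gaugeModulus
    (fun a : Fin 1 → M => gauge (a 0))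

/-! ### Formulae -/

/-- Expressions of unbounded continuous logic in the variables `x₀, …, xₙ₋₁`, with the connectives
`1`, `x/2`, `x + y`, `x ∸ y`.  The quantifiers bind the last variable.  The side condition on
quantification is imposed by `PreFormula.IsFormula`. -/
inductive PreFormula (S : Signature.{u, v}) : ℕ → Type (max u v)
  | rel {n k : ℕ} (R : S.Relations k) (ts : Fin k → S.toLanguage.Term (Fin n)) : PreFormula S n
  | dist {n : ℕ} (s t : S.toLanguage.Term (Fin n)) : PreFormula S n
  | gauge {n : ℕ} (t : S.toLanguage.Term (Fin n)) : PreFormula S n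
  | one {n : ℕ} : PreFormula S n
  | half {n : ℕ} (φ : PreFormula S n) : PreFormula S n
  | add {n : ℕ} (φ ψ : PreFormula S n) : PreFormula S n
  | dotminus {n : ℕ} (φ ψ : PreFormula S n) : PreFormula S n
  | sup {n : ℕ} (φ : PreFormula S (n + 1)) : PreFormula S n
  | inf {n : ℕ} (φ : PreFormula S (n + 1)) : PreFormula S n

namespace PreFormula

variable {S : Signature.{u, v}}

/-- Syntactic boundedness. -/
def IsBounded : ∀ {n : ℕ}, PreFormula S n → Prop
  | _, rel _ _ => False
  | _, dist _ _ => False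
  | _, gauge _ => False
  | _, one => True
  | _, half φ => φ.IsBounded
  | _, add φ ψ => φ.IsBounded ∧ ψ.IsBounded
  | _, dotminus φ _ => φ.IsBounded
  | _, sup φ => φ.IsBounded
  | _, inf φ => φ.IsBounded

/-- `φ.EventuallyConst k`: the expression `φ` is syntactically eventually constant in the
variable `xₖ`. -/
def EventuallyConst : ∀ {n : ℕ}, PreFormula S n → Fin n → Prop
  | _, rel _ ts, k => ∀ i, k ∉ (ts i).varFinset
  | _, dist s t, k => k ∉ s.varFinset ∧ k ∉ t.varFinset
  | _, gauge t, k => k ∉ t.varFinset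
  | _, one, _ => True
  | _, half φ, k => φ.EventuallyConst k
  | _, add φ ψ, k => φ.EventuallyConst k ∧ ψ.EventuallyConst k
  | _, dotminus φ ψ, k => (φ.EventuallyConst k ∧ ψ.EventuallyConst k) ∨
      (φ.IsBounded ∧ ψ = gauge (FirstOrder.Language.Term.var k))
  | _, sup φ, k => φ.EventuallyConst k.castSucc
  | _, inf φ, k => φ.EventuallyConst k.castSucc

/-- The formulae: one may only quantify over a variable in which the expression is syntactically
eventually constant. -/
def IsFormula : ∀ {n : ℕ}, PreFormula S n → Prop
  | _, rel _ _ => True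
  | _, dist _ _ => True
  | _, gauge _ => True
  | _, one => True
  | _, half φ => φ.IsFormula
  | _, add φ ψ => φ.IsFormula ∧ ψ.IsFormula
  | _, dotminus φ ψ => φ.IsFormula ∧ ψ.IsFormula
  | n, sup φ => φ.IsFormula ∧ φ.EventuallyConst (Fin.last n)
  | n, inf φ => φ.IsFormula ∧ φ.EventuallyConst (Fin.last n)

end PreFormula

/-- Regard a term in which `xₖ` does not occur as a term in the remaining variables, which keep
their order. -/
def dropVar {L : FirstOrder.Language.{u, v}} {n : ℕ} (k : Fin (n + 1)) (t : L.Term (Fin (n + 1)))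
    (h : k ∉ t.varFinset) : L.Term (Fin n) :=
  t.restrictVar fun j => (finSuccAboveEquiv k).symm ⟨j.1, fun e => h (e ▸ j.2)⟩

namespace PreFormula

variable {S : Signature.{u, v}}

open Classical in
/-- The expression `φ(∞, ȳ)` in the remaining variables, obtained by putting the formal infinity
for the variable `xₖ`.  It is meaningful when `φ` is syntactically eventually constant in `xₖ`; an
atomic formula in which `xₖ` occurs is sent to the arbitrary value `1`. -/
noncomputable def atInfty : ∀ {n : ℕ}, PreFormula S (n + 1) → Fin (n + 1) → PreFormula S n
  | _, rel R ts, k =>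
      if h : ∀ i, k ∉ (ts i).varFinset then rel R (fun i => dropVar k (ts i) (h i)) else one
  | _, dist s t, k =>
      if h : k ∉ s.varFinset ∧ k ∉ t.varFinset then dist (dropVar k s h.1) (dropVar k t h.2)
      else one
  | _, gauge t, k => if h : k ∉ t.varFinset then gauge (dropVar k t h) else one
  | _, one, _ => one
  | _, half φ, k => half (φ.atInfty k)
  | _, add φ ψ, k => add (φ.atInfty k) (ψ.atInfty k)
  | _, dotminus φ ψ, k =>
      if φ.IsBounded ∧ ψ = gauge (FirstOrder.Language.Term.var k) then
        dotminus one one -- the constant `0`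
      else dotminus (φ.atInfty k) (ψ.atInfty k)
  | _, sup φ, k => sup (φ.atInfty k.castSucc)
  | _, inf φ, k => inf (φ.atInfty k.castSucc)

/-- The complexity of an expression. -/
def depth : ∀ {n : ℕ}, PreFormula S n → ℕ
  | _, rel _ _ => 0
  | _, dist _ _ => 0
  | _, gauge _ => 0
  | _, one => 0
  | _, half φ => φ.depth + 1
  | _, add φ ψ => max φ.depth ψ.depth + 1
  | _, dotminus φ ψ => max φ.depth ψ.depth + 1
  | _, sup φ => φ.depth + 1
  | _, inf φ => φ.depth + 1

theorem depth_atInfty_le : ∀ {n : ℕ} (φ : PreFormula S (n + 1)) (k : Fin (n + 1)),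
    (φ.atInfty k).depth ≤ φ.depth
  | _, rel R ts, k => by rw [atInfty]; split_ifs <;> simp [depth]
  | _, dist s t, k => by rw [atInfty]; split_ifs <;> simp [depth]
  | _, gauge t, k => by rw [atInfty]; split_ifs <;> simp [depth]
  | _, one, _ => by simp [atInfty, depth]
  | _, half φ, k => by
      have := depth_atInfty_le φ k
      simpa [atInfty, depth] using this
  | _, add φ ψ, k => by
      have h1 := depth_atInfty_le φ k
      have h2 := depth_atInfty_le ψ k
      simp only [atInfty, depth]
      omega
  | _, dotminus φ ψ, k => by
      have h1 := depth_atInfty_le φ k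
      have h2 := depth_atInfty_le ψ k
      rw [atInfty]
      split_ifs <;> simp only [depth] <;> omega
  | _, sup φ, k => by
      have := depth_atInfty_le φ k.castSucc
      simpa [atInfty, depth] using this
  | _, inf φ, k => by
      have := depth_atInfty_le φ k.castSucc
      simpa [atInfty, depth] using this

end PreFormula

/-! ### Semantics -/

section Semantics

variable {S : Signature.{u, v}} {M : Type w} [PseudoMetricSpace M] [PreStructure S M]

/-- Interpretation of terms. -/
def termValue {n : ℕ} (a : Fin n → M) : S.toLanguage.Term (Fin n) → M
  | .var j => a j
  | .func f ts => PreStructure.func (S := S) f fun i => termValue a (ts i)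

/-- Interpretation of formulae.  Quantifiers range over `M ∪ {∞} = Option M`, where the value of
`φ(x, ȳ)` at `x = ∞` is the value of `φ(∞, ȳ)`.  Suprema are taken in `[0,∞]`. -/
noncomputable def eval : ∀ {n : ℕ}, PreFormula S n → (Fin n → M) → ℝ≥0∞
  | _, .rel R ts, a => (PreStructure.rel (S := S) R fun i => termValue a (ts i) : ℝ≥0)
  | _, .dist s t, a => (nndist (termValue a s) (termValue a t) : ℝ≥0)
  | _, .gauge t, a => (PreStructure.gauge S (termValue a t) : ℝ≥0)
  | _, .one, _ => 1
  | _, .half φ, a => eval φ a / 2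
  | _, .add φ ψ, a => eval φ a + eval ψ a
  | _, .dotminus φ ψ, a => eval φ a - eval ψ a
  | n, .sup φ, a => ⨆ b : Option M,
      match b with
      | none => eval (φ.atInfty (Fin.last n)) a
      | some b => eval φ (Fin.snoc a b)
  | n, .inf φ, a => ⨅ b : Option M,
      match b with
      | none => eval (φ.atInfty (Fin.last n)) a
      | some b => eval φ (Fin.snoc a b)
termination_by _ φ _ => φ.depth
decreasing_by
  all_goals
    first
    | (simp only [PreFormula.depth]; omega)
    | (have := PreFormula.depth_atInfty_le φ (Fin.last n); simp only [PreFormula.depth]; omega)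

end Semantics

/-! ### Auxiliary facts on `RespectsUnder` -/

section Aux

theorem RespectsUnder.gauge_le {X Y : Type*} [PseudoMetricSpace X] [PseudoMetricSpace Y]
    {νX : X → ℝ≥0} {νY : Y → ℝ≥0} {δ : ContinuityModulus} {f : X → Y}
    (h : RespectsUnder νX νY δ f) {ε : ℝ} (hε : 0 < ε) {a : X} (ha : (νX a : ℝ) < 1 / ε) :
    (νY (f a) : ℝ) ≤ 1 / δ ε :=
  (h ε hε a a ha ha (by simpa using δ.pos ε hε)).2

theorem tupleGauge_lt_iff {X : Type*} {ν : X → ℝ≥0} {n : ℕ} {a : Fin n → X} {ε : ℝ}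
    (hε : 0 < ε) : ((tupleGauge ν a : ℝ≥0) : ℝ) < 1 / ε ↔ ∀ i, (ν (a i) : ℝ) < 1 / ε := by
  have hpos : (0 : ℝ) < 1 / ε := by positivity
  lift (1 / ε) to ℝ≥0 using hpos.le with r
  have hr : ⊥ < r := by exact_mod_cast hpos
  rw [tupleGauge, NNReal.coe_lt_coe, Finset.sup_lt_iff hr]
  simp

theorem continuous_tupleGauge {X : Type*} [TopologicalSpace X] {ν : X → ℝ≥0} (hν : Continuous ν)
    (n : ℕ) : Continuous (tupleGauge ν : (Fin n → X) → ℝ≥0) := by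
  unfold tupleGauge
  exact Continuous.finset_sup_apply fun i _ => hν.comp (continuous_apply i)

theorem isBounded_of_dist_respects {M : Type*} [PseudoMetricSpace M] {ν : M → ℝ≥0}
    {δ : ContinuityModulus}
    (h : RespectsUnder (tupleGauge ν) id δ (fun a : Fin 2 → M => nndist (a 0) (a 1))) (r : ℝ≥0) :
    Bornology.IsBounded {a : M | ν a ≤ r} := by
  have hε : (0 : ℝ) < 1 / (r + 1) := by positivity
  refine Metric.isBounded_iff.2 ⟨1 / δ (1 / (r + 1)), fun a ha b hb => ?_⟩
  have := h.gauge_le hε (a := ![a, b]) (by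
    rw [tupleGauge_lt_iff hε]
    have h1 : (ν a : ℝ) ≤ r := by exact_mod_cast ha
    have h2 : (ν b : ℝ) ≤ r := by exact_mod_cast hb
    intro i
    fin_cases i <;> simp <;> linarith)
  simpa using this

end Aux

/-! ### The structure associated with a pre-structure

`Completion X` divides the pseudo-metric space `X` by the zero distance relation and completes it.
The symbols are extended by continuity. -/

section CompletionStructure

variable {S : Signature.{u, v}} {X : Type w} [PseudoMetricSpace X]

theorem isDenseInducing_tuple (X : Type w) [PseudoMetricSpace X] (n : ℕ) :
    IsDenseInducing (fun (a : Fin n → X) (i : Fin n) => (a i : Completion X)) where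
  toIsInducing := IsInducing.piMap fun _ => Completion.isDenseInducing_coe.isInducing
  dense := DenseRange.piMap fun _ => Completion.denseRange_coe

/-- The extension by continuity of a map defined on `Xⁿ`. -/
noncomputable def extendTuple {Y : Type*} [TopologicalSpace Y] {n : ℕ} (g : (Fin n → X) → Y) :
    (Fin n → Completion X) → Y :=
  (isDenseInducing_tuple X n).extend g

/-- The extension by continuity of a gauge. -/
noncomputable def extendGauge (ν : X → ℝ≥0) : Completion X → ℝ≥0 := Completion.extension ν

theorem extendGauge_lipschitz {ν : X → ℝ≥0} (hν : LipschitzWith 1 ν) :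
    LipschitzWith 1 (extendGauge ν) := hν.completion_extension

theorem extendGauge_coe {ν : X → ℝ≥0} (hν : LipschitzWith 1 ν) (a : X) :
    extendGauge ν (a : Completion X) = ν a := Completion.extension_coe hν.uniformContinuous a

theorem dist_coe_tuple {n : ℕ} (a b : Fin n → X) :
    dist (fun i => (a i : Completion X)) (fun i => (b i : Completion X)) = dist a b := by
  simp [dist_pi_def, nndist_dist]

theorem tupleGauge_coe {ν : X → ℝ≥0} (hν : LipschitzWith 1 ν) {n : ℕ} (a : Fin n → X) :
    tupleGauge (extendGauge ν) (fun i => (a i : Completion X)) = tupleGauge ν a := by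
  simp [tupleGauge, extendGauge_coe hν]

theorem exists_tendsto_extend {Y : Type*} [PseudoMetricSpace Y] [CompleteSpace Y] {n : ℕ}
    {ν : X → ℝ≥0} (hν : LipschitzWith 1 ν) {νY : Y → ℝ≥0} {δ : ContinuityModulus}
    {g : (Fin n → X) → Y} (hg : RespectsUnder (tupleGauge ν) νY δ g) (b : Fin n → Completion X) :
    ∃ c, Tendsto g (comap (fun (a : Fin n → X) (i : Fin n) => (a i : Completion X)) (𝓝 b))
      (𝓝 c) := by
  have := (isDenseInducing_tuple X n).comap_nhds_neBot b
  refine CompleteSpace.complete (f := map g _) ?_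
  rw [Metric.cauchy_iff]
  refine ⟨inferInstance, fun η hη => ?_⟩
  set C : ℝ := (tupleGauge (extendGauge ν) b : ℝ) + 1 with hC
  have hCpos : 0 < C := by positivity
  set ε : ℝ := min (η / 2) (1 / C) with hεdef
  have hε : 0 < ε := by positivity
  have hCε : C ≤ 1 / ε := by
    rw [le_div_iff₀ hε]
    calc C * ε ≤ C * (1 / C) := by gcongr; exact min_le_right _ _
      _ = 1 := by field_simp
  have hcont : Continuous (tupleGauge (extendGauge ν) : (Fin n → Completion X) → ℝ≥0) :=
    continuous_tupleGauge (extendGauge_lipschitz hν).continuous n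
  have h1 : ∀ᶠ y in 𝓝 b, ((tupleGauge (extendGauge ν) y : ℝ≥0) : ℝ) < C :=
    (NNReal.continuous_coe.comp hcont).continuousAt.eventually_lt continuousAt_const
      (by simp [hC])
  have h2 : ∀ᶠ y in 𝓝 b, dist y b < δ ε / 2 :=
    Metric.ball_mem_nhds b (half_pos (δ.pos ε hε))
  refine ⟨_, image_mem_map (preimage_mem_comap (h1.and h2)), ?_⟩
  rintro _ ⟨y, ⟨hy1, hy2⟩, rfl⟩ _ ⟨z, ⟨hz1, hz2⟩, rfl⟩
  rw [tupleGauge_coe hν] at hy1 hz1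
  have hd : dist y z < δ ε := by
    rw [← dist_coe_tuple]
    refine (dist_triangle_right _ _ b).trans_lt ?_
    linarith
  have := (hg ε hε y z (hy1.trans_le hCε) (hz1.trans_le hCε) hd).1
  have h3 : ε ≤ η / 2 := min_le_left _ _
  linarith

theorem continuous_extendTuple {Y : Type*} [MetricSpace Y] [CompleteSpace Y] {n : ℕ}
    {ν : X → ℝ≥0} (hν : LipschitzWith 1 ν) {νY : Y → ℝ≥0} {δ : ContinuityModulus}
    {g : (Fin n → X) → Y} (hg : RespectsUnder (tupleGauge ν) νY δ g) :
    Continuous (extendTuple g) :=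
  (isDenseInducing_tuple X n).continuous_extend (exists_tendsto_extend hν hg)

theorem continuous_of_respects {Y : Type*} [PseudoMetricSpace Y] {n : ℕ}
    {ν : X → ℝ≥0} (hν : LipschitzWith 1 ν) {νY : Y → ℝ≥0} {δ : ContinuityModulus}
    {g : (Fin n → X) → Y} (hg : RespectsUnder (tupleGauge ν) νY δ g) : Continuous g := by
  rw [continuous_iff_continuousAt]
  intro b
  rw [ContinuousAt, Metric.tendsto_nhds]
  intro η hη
  set C : ℝ := (tupleGauge ν b : ℝ) + 1 with hC
  have hCpos : 0 < C := by positivity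
  set ε : ℝ := min (η / 2) (1 / C) with hεdef
  have hε : 0 < ε := by positivity
  have hCε : C ≤ 1 / ε := by
    rw [le_div_iff₀ hε]
    calc C * ε ≤ C * (1 / C) := by gcongr; exact min_le_right _ _
      _ = 1 := by field_simp
  have h1 : ∀ᶠ y in 𝓝 b, ((tupleGauge ν y : ℝ≥0) : ℝ) < C :=
    (NNReal.continuous_coe.comp (continuous_tupleGauge hν.continuous n)).continuousAt.eventually_lt
      continuousAt_const (by simp [hC])
  have h2 : ∀ᶠ y in 𝓝 b, dist y b < δ ε := Metric.ball_mem_nhds b (δ.pos ε hε)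
  filter_upwards [h1, h2] with y hy1 hy2
  have := (hg ε hε y b (hy1.trans_le hCε) (lt_of_lt_of_le (by simp [hC]) hCε) hy2).1
  have h3 : ε ≤ η / 2 := min_le_left _ _
  linarith

theorem extendTuple_coe {Y : Type*} [MetricSpace Y] {n : ℕ}
    {ν : X → ℝ≥0} (hν : LipschitzWith 1 ν) {νY : Y → ℝ≥0} {δ : ContinuityModulus}
    {g : (Fin n → X) → Y} (hg : RespectsUnder (tupleGauge ν) νY δ g) (a : Fin n → X) :
    extendTuple g (fun i => (a i : Completion X)) = g a :=
  (isDenseInducing_tuple X n).extend_eq (continuous_of_respects hν hg) a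

/-- A continuous map on `(Completion X)ⁿ` respects `δ` under `ν` as soon as it does so on the
tuples coming from `X`. -/
theorem respects_of_dense {Y : Type*} [PseudoMetricSpace Y] {n : ℕ}
    {ν : X → ℝ≥0} (hν : LipschitzWith 1 ν) {νY : Y → ℝ≥0} (hνY : Continuous νY)
    {δ : ContinuityModulus} {F : (Fin n → Completion X) → Y} (hF : Continuous F)
    (h : RespectsUnder (tupleGauge ν) νY δ
      (fun a : Fin n → X => F (fun i => (a i : Completion X)))) :
    RespectsUnder (tupleGauge (extendGauge ν)) νY δ F := by
  intro ε hε a b ha hb hab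
  have hcont : Continuous (fun y : Fin n → Completion X =>
      ((tupleGauge (extendGauge ν) y : ℝ≥0) : ℝ)) :=
    NNReal.continuous_coe.comp (continuous_tupleGauge (extendGauge_lipschitz hν).continuous n)
  let O : Set ((Fin n → Completion X) × (Fin n → Completion X)) :=
    {p | ((tupleGauge (extendGauge ν) p.1 : ℝ≥0) : ℝ) < 1 / ε ∧
      ((tupleGauge (extendGauge ν) p.2 : ℝ≥0) : ℝ) < 1 / ε ∧ dist p.1 p.2 < δ ε}
  have hO : IsOpen O :=
    (isOpen_lt (hcont.comp continuous_fst) continuous_const).inter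
      ((isOpen_lt (hcont.comp continuous_snd) continuous_const).inter
        (isOpen_lt (continuous_fst.dist continuous_snd) continuous_const))
  let K : Set ((Fin n → Completion X) × (Fin n → Completion X)) :=
    {p | dist (F p.1) (F p.2) ≤ ε ∧ (νY (F p.1) : ℝ) ≤ 1 / δ ε}
  have hK : IsClosed K :=
    (isClosed_le ((hF.comp continuous_fst).dist (hF.comp continuous_snd)) continuous_const).inter
      (isClosed_le (NNReal.continuous_coe.comp (hνY.comp (hF.comp continuous_fst)))
        continuous_const)
  have hd := ((isDenseInducing_tuple X n).prodMap (isDenseInducing_tuple X n)).dense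
  have hsub : O ⊆ K := by
    refine (hd.open_subset_closure_inter hO).trans (closure_minimal ?_ hK)
    rintro _ ⟨⟨h1, h2, h3⟩, ⟨⟨y, z⟩, rfl⟩⟩
    simp only [Prod.map_apply] at h1 h2 h3
    rw [tupleGauge_coe hν] at h1 h2
    rw [dist_coe_tuple] at h3
    exact h ε hε y z h1 h2 h3
  exact hsub (show (a, b) ∈ O from ⟨ha, hb, hab⟩)

theorem respects_coe_comp {n : ℕ} {ν : X → ℝ≥0} (hν : LipschitzWith 1 ν) {δ : ContinuityModulus}
    {g : (Fin n → X) → X} (hg : RespectsUnder (tupleGauge ν) ν δ g) :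
    RespectsUnder (tupleGauge ν) (extendGauge ν) δ (fun a => (g a : Completion X)) := by
  intro ε hε a b ha hb hab
  rw [Completion.dist_eq, extendGauge_coe hν]
  exact hg ε hε a b ha hb hab

/-- The structure associated with a pre-structure. -/
noncomputable instance completionPreStructure [PreStructure S X] :
    PreStructure S (Completion X) :=
  have hν : LipschitzWith 1 (PreStructure.gauge S : X → ℝ≥0) := PreStructure.gauge_lipschitz
  have hd : RespectsUnder (tupleGauge (extendGauge (PreStructure.gauge S : X → ℝ≥0))) id
      S.distModulus (fun a : Fin 2 → Completion X => nndist (a 0) (a 1)) := by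
    refine respects_of_dense hν continuous_id
      ((continuous_apply 0).nndist (continuous_apply 1)) ?_
    have := PreStructure.dist_respects (S := S) (M := X)
    simpa [nndist_dist] using this
  { gauge := extendGauge (PreStructure.gauge S)
    func := fun f => extendTuple fun a : Fin _ → X =>
      ((PreStructure.func (S := S) f a : X) : Completion X)
    rel := fun R => extendTuple (PreStructure.rel (S := S) R)
    gauge_lipschitz := extendGauge_lipschitz hν
    isBounded_gaugeBall := isBounded_of_dist_respects hd
    func_respects := fun f => by
      have hf := respects_coe_comp hν (PreStructure.func_respects (S := S) (M := X) f)
      refine respects_of_dense hν (extendGauge_lipschitz hν).continuous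
        (continuous_extendTuple hν hf) ?_
      simp_rw [extendTuple_coe hν hf]
      exact hf
    rel_respects := fun R => by
      have hR := PreStructure.rel_respects (S := S) (M := X) R
      refine respects_of_dense hν continuous_id (continuous_extendTuple hν hR) ?_
      simp_rw [extendTuple_coe hν hR]
      exact hR
    dist_respects := hd
    gauge_respects := by
      refine respects_of_dense hν continuous_id
        ((extendGauge_lipschitz hν).continuous.comp (continuous_apply 0)) ?_
      have h := PreStructure.gauge_respects (S := S) (M := X)
      intro ε hε a b ha hb hab
      have := h ε hε a b ha hb hab
      simpa only [Function.comp_apply, extendGauge_coe hν] using this }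

end CompletionStructure

/-! ### Ultraproducts -/

section Ultraproduct

variable (S : Signature.{u, v}) {I : Type x} (M : I → Type w) [∀ i, PseudoMetricSpace (M i)]
  [∀ i, PreStructure S (M i)] (U : Ultrafilter I)

/-- The set `N₀`: families `(aᵢ)` indexed by `I₀ = {i | Mᵢ ≠ ∅}`, whose gauge is bounded on a
`U`-large set of indices (i.e. `lim_U ν(aᵢ) < ∞`).  It is empty unless `I₀ ∈ U`. -/
def PreUltraproduct : Type (max w x) :=
  {a : ∀ i, Nonempty (M i) → M i //
    ∃ C : ℝ≥0, ∀ᶠ i in (U : Filter I), ∃ h : Nonempty (M i), PreStructure.gauge S (a i h) ≤ C}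

variable {S M U}

/-- The tuple `(a₀ᵢ, …, aₙ₋₁,ᵢ)` of `Mᵢ`, for a tuple `(a₀, …, aₙ₋₁)` of `N₀`.  It exists as soon
as `Mᵢⁿ` is not empty: always if `n = 0`, and if and only if `i ∈ I₀` otherwise. -/
def coordTuple {n : ℕ} (a : Fin n → PreUltraproduct S M U) (i : I) (h : Nonempty (Fin n → M i)) :
    Fin n → M i :=
  fun j => (a j).1 i (h.map fun c => c j)

open Classical in
/-- The family of values `g(a₀ᵢ, …, aₙ₋₁,ᵢ)`, extended by `0` to the (`U`-negligible) set of
those indices where the tuple does not exist. -/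
noncomputable def coordValue {β : Type*} [Zero β] {n : ℕ} (g : ∀ i, (Fin n → M i) → β)
    (a : Fin n → PreUltraproduct S M U) (i : I) : β :=
  if h : Nonempty (Fin n → M i) then g i (coordTuple a i h) else 0

/-- The `U`-limit of the values `g(a₀ᵢ, …, aₙ₋₁,ᵢ)`. -/
noncomputable def ultraLimit {n : ℕ} (g : ∀ i, (Fin n → M i) → ℝ≥0)
    (a : Fin n → PreUltraproduct S M U) : ℝ≥0 :=
  limUnder (U : Filter I) (coordValue g a)

theorem PreUltraproduct.exists_bound {n : ℕ} (a : Fin n → PreUltraproduct S M U) :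
    ∃ ε : ℝ, 0 < ε ∧ ∀ᶠ i in (U : Filter I), ∃ h : Nonempty (Fin n → M i),
      ((tupleGauge (PreStructure.gauge S) (coordTuple a i h) : ℝ≥0) : ℝ) < 1 / ε := by
  choose C hC using fun j => (a j).2
  set D : ℝ≥0 := Finset.univ.sup C with hD
  have hε : (0 : ℝ) < 1 / (D + 1) := by positivity
  refine ⟨1 / (D + 1), hε, ?_⟩
  filter_upwards [eventually_all.2 hC] with i hi
  refine ⟨⟨fun j => (a j).1 i (hi j).1⟩, ?_⟩
  rw [tupleGauge_lt_iff hε]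
  intro j
  obtain ⟨h, hj⟩ := hi j
  have h1 : PreStructure.gauge S ((a j).1 i h) ≤ D := hj.trans (Finset.le_sup (Finset.mem_univ j))
  have h2 : ((PreStructure.gauge S ((a j).1 i h) : ℝ≥0) : ℝ) ≤ D := by exact_mod_cast h1
  rw [one_div_one_div]
  exact h2.trans_lt (by linarith)

theorem PreUltraproduct.eventually_nonempty {n : ℕ} (a : Fin n → PreUltraproduct S M U) :
    ∀ᶠ i in (U : Filter I), Nonempty (Fin n → M i) := by
  obtain ⟨ε, -, h⟩ := PreUltraproduct.exists_bound a
  filter_upwards [h] with i hi using hi.1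

theorem tendsto_ultraLimit_of_bound {n : ℕ} {g : ∀ i, (Fin n → M i) → ℝ≥0}
    {a : Fin n → PreUltraproduct S M U} {C : ℝ}
    (h : ∀ᶠ i in (U : Filter I), ((coordValue g a i : ℝ≥0) : ℝ) ≤ C) :
    Tendsto (coordValue g a) U (𝓝 (ultraLimit g a)) := by
  refine tendsto_nhds_limUnder ?_
  have hK : IsCompact (Set.Icc (0 : ℝ≥0) C.toNNReal) := isCompact_Icc
  obtain ⟨c, -, hc⟩ := hK.ultrafilter_le_nhds (U.map (coordValue g a)) (by
    rw [le_principal_iff]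
    change ∀ᶠ i in (U : Filter I), coordValue g a i ∈ _
    filter_upwards [h] with i hi
    exact ⟨zero_le, NNReal.le_toNNReal_of_coe_le hi⟩)
  exact ⟨c, hc⟩

/-- The limits which define the predicates on `N₀` exist in `[0,∞)`. -/
theorem tendsto_ultraLimit {n : ℕ} {g : ∀ i, (Fin n → M i) → ℝ≥0} {δ : ContinuityModulus}
    (hg : ∀ i, RespectsUnder (tupleGauge (PreStructure.gauge S)) id δ (g i))
    (a : Fin n → PreUltraproduct S M U) :
    Tendsto (coordValue g a) U (𝓝 (ultraLimit g a)) := by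
  obtain ⟨ε, hε, h⟩ := PreUltraproduct.exists_bound a
  refine tendsto_ultraLimit_of_bound (C := 1 / δ ε) ?_
  filter_upwards [h] with i ⟨hi, hb⟩
  rw [coordValue, dif_pos hi]
  exact (hg i).gauge_le hε hb

/-- The gauge of `N₀`: the `U`-limit of the gauges. -/
noncomputable def preGauge (a : PreUltraproduct S M U) : ℝ≥0 :=
  ultraLimit (fun i (c : Fin 1 → M i) => PreStructure.gauge S (c 0)) ![a]

theorem tendsto_preGauge (a : PreUltraproduct S M U) :
    Tendsto (coordValue (fun i (c : Fin 1 → M i) => PreStructure.gauge S (c 0)) ![a]) U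
      (𝓝 (preGauge a)) :=
  tendsto_ultraLimit (fun _ => PreStructure.gauge_respects) _

/-- The distance of `N₀`: the `U`-limit of the distances. -/
noncomputable def preDist (a b : PreUltraproduct S M U) : ℝ≥0 :=
  ultraLimit (fun i (c : Fin 2 → M i) => nndist (c 0) (c 1)) ![a, b]

theorem tendsto_preDist (a b : PreUltraproduct S M U) :
    Tendsto (coordValue (fun i (c : Fin 2 → M i) => nndist (c 0) (c 1)) ![a, b]) U
      (𝓝 (preDist a b)) :=
  tendsto_ultraLimit (fun _ => PreStructure.dist_respects) _

theorem coordValue_gauge (a : PreUltraproduct S M U) {i : I} (h : Nonempty (M i)) :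
    coordValue (fun i (c : Fin 1 → M i) => PreStructure.gauge S (c 0)) ![a] i =
      PreStructure.gauge S (a.1 i h) := by
  rw [coordValue, dif_pos ⟨fun _ => h.some⟩]
  rfl

theorem coordValue_dist (a b : PreUltraproduct S M U) {i : I} (h : Nonempty (M i)) :
    coordValue (fun i (c : Fin 2 → M i) => nndist (c 0) (c 1)) ![a, b] i =
      nndist (a.1 i h) (b.1 i h) := by
  rw [coordValue, dif_pos ⟨fun _ => h.some⟩]
  rfl

theorem PreUltraproduct.eventually_nonempty_one (a : PreUltraproduct S M U) :
    ∀ᶠ i in (U : Filter I), Nonempty (M i) := by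
  obtain ⟨C, h⟩ := a.2
  filter_upwards [h] with i hi using hi.1

noncomputable instance : PseudoMetricSpace (PreUltraproduct S M U) where
  dist a b := preDist a b
  dist_self a := by
    have h := tendsto_preDist a a
    have h' : Tendsto (coordValue (fun i (c : Fin 2 → M i) => nndist (c 0) (c 1)) ![a, a]) U
        (𝓝 0) := by
      refine tendsto_const_nhds.congr' ?_
      filter_upwards [a.eventually_nonempty_one] with i hi
      rw [coordValue_dist a a hi, nndist_self]
    rw [tendsto_nhds_unique h h', NNReal.coe_zero]
  dist_comm a b := by
    have h := tendsto_preDist a b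
    have h' : Tendsto (coordValue (fun i (c : Fin 2 → M i) => nndist (c 0) (c 1)) ![a, b]) U
        (𝓝 (preDist b a)) := by
      refine (tendsto_preDist b a).congr' ?_
      filter_upwards [a.eventually_nonempty_one] with i hi
      rw [coordValue_dist a b hi, coordValue_dist b a hi, nndist_comm]
    rw [tendsto_nhds_unique h h']
  dist_triangle a b c := by
    rw [← NNReal.coe_add, NNReal.coe_le_coe]
    refine le_of_tendsto_of_tendsto (tendsto_preDist a c)
      ((tendsto_preDist a b).add (tendsto_preDist b c)) ?_
    filter_upwards [a.eventually_nonempty_one] with i hi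
    rw [coordValue_dist a b hi, coordValue_dist a c hi, coordValue_dist b c hi]
    exact nndist_triangle _ _ _

theorem PreUltraproduct.nndist_eq (a b : PreUltraproduct S M U) : nndist a b = preDist a b := rfl

theorem eventually_gauge_lt {n : ℕ} {a : Fin n → PreUltraproduct S M U} {ε : ℝ} (hε : 0 < ε)
    (ha : ((tupleGauge preGauge a : ℝ≥0) : ℝ) < 1 / ε) :
    ∀ᶠ i in (U : Filter I), ∀ h : Nonempty (Fin n → M i),
      ((tupleGauge (PreStructure.gauge S) (coordTuple a i h) : ℝ≥0) : ℝ) < 1 / ε := by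
  rw [tupleGauge_lt_iff hε] at ha
  have key : ∀ᶠ i in (U : Filter I), ∀ j, ((coordValue (fun i (c : Fin 1 → M i) =>
      PreStructure.gauge S (c 0)) ![a j] i : ℝ≥0) : ℝ) < 1 / ε :=
    eventually_all.2 fun j =>
      ((NNReal.continuous_coe.tendsto _).comp (tendsto_preGauge (a j))).eventually_lt_const (ha j)
  filter_upwards [key] with i hi h
  rw [tupleGauge_lt_iff hε]
  intro j
  have := hi j
  rw [coordValue_gauge (a j) (h.map fun c => c j)] at this
  exact this

theorem eventually_dist_lt {n : ℕ} {a b : Fin n → PreUltraproduct S M U} {r : ℝ} (hr : 0 < r)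
    (hab : dist a b < r) :
    ∀ᶠ i in (U : Filter I), ∀ h : Nonempty (Fin n → M i),
      dist (coordTuple a i h) (coordTuple b i h) < r := by
  rw [dist_pi_lt_iff hr] at hab
  have key : ∀ᶠ i in (U : Filter I), ∀ j, ((coordValue (fun i (c : Fin 2 → M i) =>
      nndist (c 0) (c 1)) ![a j, b j] i : ℝ≥0) : ℝ) < r :=
    eventually_all.2 fun j =>
      ((NNReal.continuous_coe.tendsto _).comp (tendsto_preDist (a j) (b j))).eventually_lt_const
        (hab j)
  filter_upwards [key] with i hi h
  rw [dist_pi_lt_iff hr]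
  intro j
  have := hi j
  rw [coordValue_dist (a j) (b j) (h.map fun c => c j)] at this
  exact this

/-- Predicates defined as ultralimits respect the same continuity modulus. -/
theorem respects_ultraLimit {n : ℕ} {g : ∀ i, (Fin n → M i) → ℝ≥0} {δ : ContinuityModulus}
    (hg : ∀ i, RespectsUnder (tupleGauge (PreStructure.gauge S)) id δ (g i)) :
    RespectsUnder (tupleGauge preGauge) id δ
      (ultraLimit g : (Fin n → PreUltraproduct S M U) → ℝ≥0) := by
  intro ε hε a b ha hb hab
  have hall : ∀ᶠ i in (U : Filter I), dist (coordValue g a i) (coordValue g b i) ≤ ε ∧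
      ((coordValue g a i : ℝ≥0) : ℝ) ≤ 1 / δ ε := by
    filter_upwards [eventually_gauge_lt hε ha, eventually_gauge_lt hε hb,
      eventually_dist_lt (δ.pos ε hε) hab, PreUltraproduct.eventually_nonempty a]
      with i h1 h2 h3 h
    rw [coordValue, coordValue, dif_pos h, dif_pos h]
    exact hg i ε hε _ _ (h1 h) (h2 h) (h3 h)
  exact ⟨le_of_tendsto ((tendsto_ultraLimit hg a).dist (tendsto_ultraLimit hg b))
      (hall.mono fun _ h => h.1),
    le_of_tendsto ((NNReal.continuous_coe.tendsto _).comp (tendsto_ultraLimit hg a))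
      (hall.mono fun _ h => h.2)⟩

/-- Function symbols act coordinatewise on `N₀`. -/
def preFunc {n : ℕ} (f : S.Functions n) (a : Fin n → PreUltraproduct S M U) :
    PreUltraproduct S M U :=
  ⟨fun i h => PreStructure.func (S := S) f (coordTuple a i (h.map fun c _ => c)), by
    obtain ⟨ε, hε, h⟩ := PreUltraproduct.exists_bound a
    refine ⟨(1 / S.funcModulus f ε).toNNReal, ?_⟩
    filter_upwards [h] with i ⟨hi, hb⟩
    refine ⟨⟨PreStructure.func (S := S) f (coordTuple a i hi)⟩, ?_⟩
    exact NNReal.le_toNNReal_of_coe_le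
      ((PreStructure.func_respects (S := S) (M := M i) f).gauge_le hε hb)⟩

theorem respects_preFunc {n : ℕ} (f : S.Functions n) :
    RespectsUnder (tupleGauge preGauge) preGauge (S.funcModulus f)
      (preFunc f : (Fin n → PreUltraproduct S M U) → PreUltraproduct S M U) := by
  intro ε hε a b ha hb hab
  have hall : ∀ᶠ i in (U : Filter I),
      ((coordValue (fun i (c : Fin 2 → M i) => nndist (c 0) (c 1))
        ![preFunc f a, preFunc f b] i : ℝ≥0) : ℝ) ≤ ε ∧
      ((coordValue (fun i (c : Fin 1 → M i) => PreStructure.gauge S (c 0))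
        ![preFunc f a] i : ℝ≥0) : ℝ) ≤ 1 / S.funcModulus f ε := by
    filter_upwards [eventually_gauge_lt hε ha, eventually_gauge_lt hε hb,
      eventually_dist_lt ((S.funcModulus f).pos ε hε) hab, PreUltraproduct.eventually_nonempty a,
      (preFunc f a).eventually_nonempty_one] with i h1 h2 h3 h h'
    rw [coordValue_dist _ _ h', coordValue_gauge _ h']
    exact PreStructure.func_respects (S := S) (M := M i) f ε hε _ _ (h1 h) (h2 h) (h3 h)
  exact ⟨le_of_tendsto ((NNReal.continuous_coe.tendsto _).comp (tendsto_preDist _ _))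
      (hall.mono fun _ h => h.1),
    le_of_tendsto ((NNReal.continuous_coe.tendsto _).comp (tendsto_preGauge _))
      (hall.mono fun _ h => h.2)⟩

theorem preGauge_lipschitz :
    LipschitzWith 1 (preGauge : PreUltraproduct S M U → ℝ≥0) := by
  refine LipschitzWith.of_dist_le_mul fun a b => ?_
  rw [NNReal.coe_one, one_mul]
  refine le_of_tendsto_of_tendsto ((tendsto_preGauge a).dist (tendsto_preGauge b))
    ((NNReal.continuous_coe.tendsto _).comp (tendsto_preDist a b)) ?_
  filter_upwards [a.eventually_nonempty_one] with i hi
  rw [Function.comp_apply, coordValue_gauge a hi, coordValue_gauge b hi, coordValue_dist a b hi]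
  simpa using (PreStructure.gauge_lipschitz (S := S) (M := M i)).dist_le_mul (a.1 i hi) (b.1 i hi)

theorem preDist_respects :
    RespectsUnder (tupleGauge preGauge) id S.distModulus
      (fun a : Fin 2 → PreUltraproduct S M U => nndist (a 0) (a 1)) := by
  have h := respects_ultraLimit (U := U) fun i => PreStructure.dist_respects (S := S) (M := M i)
  convert! h using 2

/-- `N₀` is a pre-structure. -/
noncomputable instance preUltraproductPreStructure : PreStructure S (PreUltraproduct S M U) where
  gauge := preGauge
  func := preFunc
  rel := fun R => ultraLimit fun i => PreStructure.rel (S := S) (M := M i) R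
  gauge_lipschitz := preGauge_lipschitz
  isBounded_gaugeBall := isBounded_of_dist_respects preDist_respects
  func_respects := respects_preFunc
  rel_respects := fun R =>
    respects_ultraLimit fun i => PreStructure.rel_respects (S := S) (M := M i) R
  dist_respects := preDist_respects
  gauge_respects := by
    have h := respects_ultraLimit (U := U) fun i => PreStructure.gauge_respects (S := S) (M := M i)
    convert! h using 2

variable (S M U)

/-- The ultraproduct `∏ Mᵢ / U`: the structure associated with the pre-structure `N₀`, i.e. the
metric completion of the quotient of `N₀` by the zero distance relation. -/
abbrev Ultraproduct : Type (max w x) := Completion (PreUltraproduct S M U)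

variable {S M U}

/-- The class `[aᵢ]` in the ultraproduct of an element `(aᵢ)` of `N₀`. -/
noncomputable def Ultraproduct.mk (a : PreUltraproduct S M U) : Ultraproduct S M U :=
  (a : Completion (PreUltraproduct S M U))

end Ultraproduct

end UnboundedLogic

/-! The proof is an induction on formulae, but `eval` is ill suited to it: at a quantifier it jumps
to `φ.atInfty`, which is not a subformula. It is therefore replaced by `evalPart`, in which every
variable takes values in M ∪ {∞}. A term containing a variable with value ∞ is undefined, and an
atomic formula with an undefined term has value `⊤`. Since x - ⊤ = 0 in [0,∞], this gives φ ∸ ν(∞)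
the prescribed value 0. Substitution of ∞ thus becomes assignment of ∞ (`evalPart_atInfty`), the two
semantics agree on formulae (`eval_eq_evalPart`), and `evalPart` is structurally recursive.

All statements about values concern `Admissible` assignments, in which ∞ is given only to variables
where the formula is eventually constant. Two facts make quantifiers tractable. Beyond the syntactic
threshold `φ.weight` on the gauge of x, a formula eventually constant in x equals its value at ∞
(`evalPart_update_none`), so a quantifier ranges in effect over a gauge ball together with ∞. On
gauge balls, formulae are bounded and uniformly continuous (`evalPart_unif`); uniformity is what
survives suprema and infima. This gives finiteness, and continuity in a single variable.

The quantifier step of Łoś's theorem is `tendsto_iSup_ultraproduct`. A strict lower bound for the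
supremum over the ultraproduct is witnessed at ∞ or, by density and continuity, by an element of N₀,
and it passes to U-almost all coordinates. Conversely, witnesses to a large supremum in U-almost all
Mᵢ may be taken to be ∞ or of gauge at most the threshold. The ultrafilter selects one of the two
cases, and in the second the uniform gauge bound makes the family of witnesses an element of N₀.
Infima follow by reversing the order. -/

namespace UnboundedLogic

/-! ### Tuples in M ∪ {∞} -/

section PartialTuples

open Classical in
/-- A tuple of optional elements as an optional tuple. -/
noncomputable def seqTuple {M : Type*} {k : ℕ} (y : Fin k → Option M) : Option (Fin k → M) :=
  if h : ∀ i, (y i).isSome then some fun i => (y i).get (h i) else none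

theorem seqTuple_eq_some_iff {M : Type*} {k : ℕ} {y : Fin k → Option M} {c : Fin k → M} :
    seqTuple y = some c ↔ ∀ i, y i = some (c i) := by
  unfold seqTuple
  constructor
  · intro h i
    split_ifs at h with h'
    cases h
    simp
  · intro h
    have h' : ∀ i, (y i).isSome := fun i => by simp [h i]
    rw [dif_pos h']
    simp [h]

@[simp]
theorem seqTuple_some {M : Type*} {k : ℕ} (c : Fin k → M) :
    seqTuple (fun i => some (c i)) = some c :=
  seqTuple_eq_some_iff.2 fun _ => rfl

theorem exists_seqTuple_eq_some {M : Type*} {k : ℕ} {y : Fin k → Option M}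
    (h : ∀ i, y i ≠ none) : ∃ c, seqTuple y = some c := by
  choose c hc using fun i => Option.ne_none_iff_exists'.1 (h i)
  exact ⟨c, seqTuple_eq_some_iff.2 hc⟩

end PartialTuples

/-! ### Semantics with variables ranging over M ∪ {∞} -/

section PartialSemantics

variable {S : Signature.{u, v}}

/-- Interpretation of terms under partial assignments. -/
noncomputable def termPart {M : Type w} [PseudoMetricSpace M] [PreStructure S M] {n : ℕ}
    (a : Fin n → Option M) : S.toLanguage.Term (Fin n) → Option M
  | .var j => a j
  | .func f ts => (seqTuple fun i => termPart a (ts i)).map (PreStructure.func (S := S) f)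

/-- The value of an atomic formula under a partial assignment; it is `∞` if a term of the formula
is undefined. -/
noncomputable def atomPart {M : Type w} [PseudoMetricSpace M] [PreStructure S M] {n k : ℕ}
    (g : (Fin k → M) → ℝ≥0) (ts : Fin k → S.toLanguage.Term (Fin n)) (a : Fin n → Option M) :
    ℝ≥0∞ :=
  (seqTuple fun i => termPart a (ts i)).elim ⊤ fun c => (g c : ℝ≥0∞)

/-- Interpretation of formulae, the variables taking values in `M ∪ {∞}`. -/
noncomputable def evalPart {M : Type w} [PseudoMetricSpace M] [PreStructure S M] :
    ∀ {n : ℕ}, PreFormula S n → (Fin n → Option M) → ℝ≥0∞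
  | _, .rel R ts, a => atomPart (PreStructure.rel (S := S) R) ts a
  | _, .dist s t, a => atomPart (fun c => nndist (c 0) (c 1)) ![s, t] a
  | _, .gauge t, a => atomPart (fun c => PreStructure.gauge S (c 0)) ![t] a
  | _, .one, _ => 1
  | _, .half φ, a => evalPart φ a / 2
  | _, .add φ ψ, a => evalPart φ a + evalPart ψ a
  | _, .dotminus φ ψ, a => evalPart φ a - evalPart ψ a
  | _, .sup φ, a => ⨆ b : Option M, evalPart φ (Fin.snoc (α := fun _ => Option M) a b)
  | _, .inf φ, a => ⨅ b : Option M, evalPart φ (Fin.snoc (α := fun _ => Option M) a b)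

variable {M : Type w} [PseudoMetricSpace M] [PreStructure S M]

theorem termPart_some {n : ℕ} (a : Fin n → M) : ∀ t : S.toLanguage.Term (Fin n),
    termPart (fun j => some (a j)) t = some (termValue a t)
  | .var j => rfl
  | .func f ts => by
      simp only [termPart, termValue, termPart_some a, seqTuple_some, Option.map_some]

theorem atomPart_some {n k : ℕ} (g : (Fin k → M) → ℝ≥0) (ts : Fin k → S.toLanguage.Term (Fin n))
    (a : Fin n → M) :
    atomPart g ts (fun j => some (a j)) = (g fun i => termValue a (ts i) : ℝ≥0) := by
  simp [atomPart, termPart_some]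

theorem termPart_congr {n : ℕ} {a a' : Fin n → Option M} : ∀ {t : S.toLanguage.Term (Fin n)},
    (∀ j ∈ t.varFinset, a j = a' j) → termPart a t = termPart a' t
  | .var j, h => h j (by simp)
  | .func f ts, h => by
      have : ∀ i, termPart a (ts i) = termPart a' (ts i) := fun i =>
        termPart_congr fun j hj => h j (by simpa using ⟨i, hj⟩)
      simp only [termPart, this]

theorem termPart_ne_none {n : ℕ} {a : Fin n → Option M} : ∀ {t : S.toLanguage.Term (Fin n)},
    (∀ j, a j = none → j ∉ t.varFinset) → termPart a t ≠ none
  | .var j, h => fun hj => h j hj (by simp)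
  | .func f ts, h => by
      obtain ⟨c, hc⟩ := exists_seqTuple_eq_some (y := fun i => termPart a (ts i)) fun i =>
        termPart_ne_none fun j hj hj' => h j hj (by simpa using ⟨i, hj'⟩)
      simp [termPart, hc]

theorem termPart_restrictVar {n m : ℕ} {a : Fin m → Option M} {a' : Fin n → Option M} :
    ∀ {t : S.toLanguage.Term (Fin n)} {f : t.varFinset → Fin m}, (∀ j, a (f j) = a' j) →
      termPart a (t.restrictVar f) = termPart a' t
  | .var j, f, h => h ⟨j, by simp⟩
  | .func F ts, f, h => by
      simp only [FirstOrder.Language.Term.restrictVar, termPart]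
      congr 2
      funext i
      exact termPart_restrictVar fun j => h (Set.inclusion _ j)

/-- Any value could be inserted at k, since the term does not depend on that variable; `none` is the
one required by `evalPart_atInfty`. -/
theorem termPart_dropVar {n : ℕ} {k : Fin (n + 1)} {t : S.toLanguage.Term (Fin (n + 1))}
    (h : k ∉ t.varFinset) (a : Fin n → Option M) :
    termPart a (dropVar k t h) = termPart (k.insertNth (α := fun _ => Option M) none a) t := by
  refine termPart_restrictVar fun j => ?_
  obtain ⟨i, hi⟩ := Fin.exists_succAbove_eq (x := j.1) (y := k) fun e => h (e ▸ j.2)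
  have : (finSuccAboveEquiv k).symm ⟨j.1, fun e => h (e ▸ j.2)⟩ = i := by
    rw [Equiv.symm_apply_eq]
    exact Subtype.ext hi.symm
  rw [this, ← hi, Fin.insertNth_apply_succAbove]

theorem mem_varFinset_restrictVar {L : FirstOrder.Language.{u, v}} {n m : ℕ} {j : Fin m} :
    ∀ {t : L.Term (Fin n)} {f : t.varFinset → Fin m},
    j ∈ (t.restrictVar f).varFinset → ∃ i, f i = j
  | .var j, f, h => ⟨_, by simpa [FirstOrder.Language.Term.restrictVar, eq_comm] using h⟩
  | .func F ts, f, h => by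
      simp only [FirstOrder.Language.Term.restrictVar, FirstOrder.Language.Term.varFinset,
        Finset.mem_biUnion, Finset.mem_univ, true_and] at h
      obtain ⟨i, hi⟩ := h
      obtain ⟨l, hl⟩ := mem_varFinset_restrictVar hi
      exact ⟨_, hl⟩

theorem notMem_varFinset_dropVar {L : FirstOrder.Language.{u, v}} {n : ℕ} {k : Fin (n + 1)}
    {j : Fin n} {t : L.Term (Fin (n + 1))} (h : k ∉ t.varFinset)
    (hj : k.succAbove j ∉ t.varFinset) : j ∉ (dropVar k t h).varFinset := by
  intro hmem
  obtain ⟨i, hi⟩ := mem_varFinset_restrictVar hmem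
  rw [Equiv.symm_apply_eq] at hi
  have : i.1 = k.succAbove j := congrArg Subtype.val hi
  exact hj (this ▸ i.2)

/-- Used to carry the substitution of ∞ for one variable under a quantifier, which binds the last
one. -/
theorem snoc_insertNth_castSucc {α : Type*} {n : ℕ} (k : Fin (n + 1)) (x b : α) (a : Fin n → α) :
    (k.castSucc.insertNth (α := fun _ => α) x (Fin.snoc (α := fun _ => α) a b) : Fin (n + 2) → α) =
      Fin.snoc (α := fun _ => α) (k.insertNth (α := fun _ => α) x a) b := by
  rw [Fin.insertNth_eq_iff]
  refine ⟨by simp, funext fun j => ?_⟩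
  induction j using Fin.lastCases with
  | last => simp [Fin.removeNth]
  | cast j =>
    simp [Fin.removeNth, Fin.castSucc_succAbove_castSucc]

/-! ### Substitution of ∞ preserves the syntactic classes -/

namespace PreFormula

theorem IsBounded.atInfty : ∀ {n : ℕ} {φ : PreFormula S (n + 1)} {k : Fin (n + 1)},
    φ.IsBounded → (φ.atInfty k).IsBounded
  | _, .rel _ _, _, h => h.elim
  | _, .dist _ _, _, h => h.elim
  | _, .gauge _, _, h => h.elim
  | _, .one, _, _ => by simp [PreFormula.atInfty, IsBounded]
  | _, .half φ, k, h => by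
      rw [PreFormula.atInfty]
      exact IsBounded.atInfty (φ := φ) h
  | _, .add φ ψ, k, h => by
      rw [PreFormula.atInfty]
      exact ⟨IsBounded.atInfty h.1, IsBounded.atInfty h.2⟩
  | _, .dotminus φ ψ, k, h => by
      rw [PreFormula.atInfty]
      split_ifs
      · trivial
      · exact IsBounded.atInfty (φ := φ) h
  | _, .sup φ, k, h => by
      rw [PreFormula.atInfty]
      exact IsBounded.atInfty (φ := φ) h
  | _, .inf φ, k, h => by
      rw [PreFormula.atInfty]
      exact IsBounded.atInfty (φ := φ) h

/-- Needed for `IsFormula.atInfty`: after substitution for an outer variable, an inner quantifier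
must still satisfy its side condition. -/
theorem EventuallyConst.atInfty : ∀ {n : ℕ} {φ : PreFormula S (n + 1)} {k : Fin (n + 1)}
    {j : Fin n}, φ.EventuallyConst k → φ.EventuallyConst (k.succAbove j) →
      (φ.atInfty k).EventuallyConst j
  | _, .rel R ts, k, j, h, hj => by
      rw [PreFormula.EventuallyConst] at h
      rw [PreFormula.atInfty, dif_pos h]
      exact fun i => notMem_varFinset_dropVar _ (hj i)
  | _, .dist s t, k, j, h, hj => by
      rw [PreFormula.EventuallyConst] at h
      rw [PreFormula.atInfty, dif_pos h]
      exact ⟨notMem_varFinset_dropVar _ hj.1, notMem_varFinset_dropVar _ hj.2⟩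
  | _, .gauge t, k, j, h, hj => by
      rw [PreFormula.EventuallyConst] at h
      rw [PreFormula.atInfty, dif_pos h]
      exact notMem_varFinset_dropVar _ hj
  | _, .one, _, _, _, _ => by simp [PreFormula.atInfty, EventuallyConst]
  | _, .half φ, k, j, h, hj => by
      rw [PreFormula.atInfty]
      exact EventuallyConst.atInfty (φ := φ) h hj
  | _, .add φ ψ, k, j, h, hj => by
      rw [PreFormula.atInfty]
      exact ⟨EventuallyConst.atInfty h.1 hj.1, EventuallyConst.atInfty h.2 hj.2⟩
  | _, .dotminus φ ψ, k, j, h, hj => by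
      rw [PreFormula.atInfty]
      split_ifs with hc
      · exact Or.inl ⟨trivial, trivial⟩
      · have h := h.resolve_right hc
        rcases hj with hj | ⟨hφ, rfl⟩
        · exact Or.inl ⟨EventuallyConst.atInfty h.1 hj.1, EventuallyConst.atInfty h.2 hj.2⟩
        -- The subtracted gauge concerns another variable, so it survives the substitution with its
        -- variable renumbered as j.
        · refine Or.inr ⟨hφ.atInfty, ?_⟩
          have h2 : k ∉ (FirstOrder.Language.Term.var (L := S.toLanguage)
            (k.succAbove j)).varFinset := h.2
          rw [PreFormula.atInfty, dif_pos h2]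
          simp only [dropVar, FirstOrder.Language.Term.restrictVar]
          congr 2
          rw [Equiv.symm_apply_eq]
          rfl
  | _, .sup φ, k, j, h, hj => by
      rw [PreFormula.atInfty]
      refine EventuallyConst.atInfty (φ := φ) h ?_
      rw [Fin.castSucc_succAbove_castSucc]
      exact hj
  | _, .inf φ, k, j, h, hj => by
      rw [PreFormula.atInfty]
      refine EventuallyConst.atInfty (φ := φ) h ?_
      rw [Fin.castSucc_succAbove_castSucc]
      exact hj

theorem IsFormula.atInfty : ∀ {n : ℕ} {φ : PreFormula S (n + 1)} {k : Fin (n + 1)},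
    φ.IsFormula → φ.EventuallyConst k → (φ.atInfty k).IsFormula
  | _, .rel R ts, k, _, h => by
      rw [PreFormula.EventuallyConst] at h
      rw [PreFormula.atInfty, dif_pos h]
      trivial
  | _, .dist s t, k, _, h => by
      rw [PreFormula.EventuallyConst] at h
      rw [PreFormula.atInfty, dif_pos h]
      trivial
  | _, .gauge t, k, _, h => by
      rw [PreFormula.EventuallyConst] at h
      rw [PreFormula.atInfty, dif_pos h]
      trivial
  | _, .one, _, _, _ => by simp [PreFormula.atInfty, IsFormula]
  | _, .half φ, k, hφ, h => by
      rw [PreFormula.atInfty]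
      exact IsFormula.atInfty (φ := φ) hφ h
  | _, .add φ ψ, k, hφ, h => by
      rw [PreFormula.atInfty]
      exact ⟨IsFormula.atInfty hφ.1 h.1, IsFormula.atInfty hφ.2 h.2⟩
  | _, .dotminus φ ψ, k, hφ, h => by
      rw [PreFormula.atInfty]
      split_ifs with hc
      · exact ⟨trivial, trivial⟩
      · have h := h.resolve_right hc
        exact ⟨IsFormula.atInfty hφ.1 h.1, IsFormula.atInfty hφ.2 h.2⟩
  | _, .sup φ, k, hφ, h => by
      rw [PreFormula.atInfty]
      refine ⟨IsFormula.atInfty hφ.1 h, EventuallyConst.atInfty h ?_⟩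
      simpa using hφ.2
  | _, .inf φ, k, hφ, h => by
      rw [PreFormula.atInfty]
      refine ⟨IsFormula.atInfty hφ.1 h, EventuallyConst.atInfty h ?_⟩
      simpa using hφ.2

end PreFormula

/-! ### Agreement of the two semantics -/

theorem atomPart_eq_top {n k : ℕ} {g : (Fin k → M) → ℝ≥0} {ts : Fin k → S.toLanguage.Term (Fin n)}
    {a : Fin n → Option M} {i : Fin k} (h : termPart a (ts i) = none) : atomPart g ts a = ⊤ := by
  have : (seqTuple fun i => termPart a (ts i)) = none := by
    by_contra hne
    obtain ⟨c, hc⟩ := Option.ne_none_iff_exists'.1 hne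
    simp [seqTuple_eq_some_iff.1 hc i] at h
  rw [atomPart, this]
  rfl

/-- The convention ν(∞) = ∞, through which truncated subtraction of a gauge yields 0 at infinity. -/
theorem evalPart_gauge_var {n : ℕ} {k : Fin n} {a : Fin n → Option M} (h : a k = none) :
    evalPart (PreFormula.gauge (S := S) (FirstOrder.Language.Term.var k)) a = ⊤ :=
  atomPart_eq_top (i := 0) h

theorem atomPart_congr {n m k : ℕ} {g : (Fin k → M) → ℝ≥0}
    {ts : Fin k → S.toLanguage.Term (Fin n)} {ts' : Fin k → S.toLanguage.Term (Fin m)}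
    {a : Fin n → Option M} {a' : Fin m → Option M}
    (h : ∀ i, termPart a (ts i) = termPart a' (ts' i)) : atomPart g ts a = atomPart g ts' a' := by
  simp only [atomPart, h]

/-- Substituting the formal infinity for a variable amounts to assigning `∞` to it. -/
theorem evalPart_atInfty : ∀ {n : ℕ} {φ : PreFormula S (n + 1)} {k : Fin (n + 1)},
    φ.EventuallyConst k → ∀ a : Fin n → Option M,
      evalPart (φ.atInfty k) a = evalPart φ (k.insertNth (α := fun _ => Option M) none a)
  | _, .rel R ts, k, h, a => by
      rw [PreFormula.EventuallyConst] at h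
      rw [PreFormula.atInfty, dif_pos h, evalPart, evalPart]
      exact atomPart_congr fun i => termPart_dropVar _ _
  | _, .dist s t, k, h, a => by
      rw [PreFormula.EventuallyConst] at h
      rw [PreFormula.atInfty, dif_pos h, evalPart, evalPart]
      refine atomPart_congr fun i => ?_
      fin_cases i
      exacts [termPart_dropVar h.1 _, termPart_dropVar h.2 _]
  | _, .gauge t, k, h, a => by
      rw [PreFormula.EventuallyConst] at h
      rw [PreFormula.atInfty, dif_pos h, evalPart, evalPart]
      refine atomPart_congr fun i => ?_
      fin_cases i
      exact termPart_dropVar h _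
  | _, .one, _, _, _ => by simp [PreFormula.atInfty, evalPart]
  | _, .half φ, k, h, a => by
      rw [PreFormula.atInfty, evalPart, evalPart, evalPart_atInfty (φ := φ) h]
  | _, .add φ ψ, k, h, a => by
      rw [PreFormula.atInfty, evalPart, evalPart, evalPart_atInfty (φ := φ) h.1,
        evalPart_atInfty (φ := ψ) h.2]
  | _, .dotminus φ ψ, k, h, a => by
      rw [PreFormula.atInfty]
      split_ifs with hc
      -- One side is the constant 1 ∸ 1, the other is x - ⊤; both are 0.
      · obtain ⟨-, rfl⟩ := hc
        rw [evalPart, evalPart, evalPart, evalPart_gauge_var (by simp), ENNReal.sub_top, tsub_self]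
      · have h := h.resolve_right hc
        rw [evalPart, evalPart, evalPart_atInfty (φ := φ) h.1, evalPart_atInfty (φ := ψ) h.2]
  | _, .sup φ, k, h, a => by
      rw [PreFormula.atInfty, evalPart, evalPart]
      refine iSup_congr fun b => ?_
      rw [evalPart_atInfty (φ := φ) h, snoc_insertNth_castSucc]
  | _, .inf φ, k, h, a => by
      rw [PreFormula.atInfty, evalPart, evalPart]
      refine iInf_congr fun b => ?_
      rw [evalPart_atInfty (φ := φ) h, snoc_insertNth_castSucc]

theorem snoc_some {α : Type*} {n : ℕ} (a : Fin n → α) (b : α) :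
    (fun j => some (Fin.snoc (α := fun _ => α) a b j)) =
      Fin.snoc (α := fun _ => Option α) (fun j => some (a j)) (some b) := by
  funext j
  induction j using Fin.lastCases <;> simp

theorem eval_eq_evalPart : ∀ {n : ℕ} {φ : PreFormula S n}, φ.IsFormula → ∀ a : Fin n → M,
    eval φ a = evalPart φ fun j => some (a j)
  | _, .rel R ts, _, a => by rw [eval, evalPart, atomPart_some]
  | _, .dist s t, _, a => by
      rw [eval, evalPart, atomPart_some]
      rfl
  | _, .gauge t, _, a => by
      rw [eval, evalPart, atomPart_some]
      rfl
  | _, .one, _, a => by rw [eval, evalPart]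
  | _, .half φ, h, a => by rw [eval, evalPart, eval_eq_evalPart (φ := φ) h]
  | _, .add φ ψ, h, a => by
      rw [eval, evalPart, eval_eq_evalPart (φ := φ) h.1, eval_eq_evalPart (φ := ψ) h.2]
  | _, .dotminus φ ψ, h, a => by
      rw [eval, evalPart, eval_eq_evalPart (φ := φ) h.1, eval_eq_evalPart (φ := ψ) h.2]
  | n, .sup φ, h, a => by
      rw [eval, evalPart]
      refine iSup_congr fun b => ?_
      cases b with
      | none =>
        -- The recursive call is on `φ.atInfty`, not on a subformula; this bound is for the
        -- termination proof.
        have := PreFormula.depth_atInfty_le φ (Fin.last n)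
        simp only
        rw [eval_eq_evalPart (h.1.atInfty h.2), evalPart_atInfty h.2, Fin.insertNth_last']
      | some b =>
        simp only
        rw [eval_eq_evalPart h.1, snoc_some]
  | n, .inf φ, h, a => by
      rw [eval, evalPart]
      refine iInf_congr fun b => ?_
      cases b with
      | none =>
        have := PreFormula.depth_atInfty_le φ (Fin.last n)
        simp only
        rw [eval_eq_evalPart (h.1.atInfty h.2), evalPart_atInfty h.2, Fin.insertNth_last']
      | some b =>
        simp only
        rw [eval_eq_evalPart h.1, snoc_some]
termination_by _ φ => φ.depth
decreasing_by
  all_goals simp only [PreFormula.depth]; omega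

/-! ### Bounds and thresholds read off from the syntax -/

namespace PreFormula

/-- A bound for the values of a bounded formula, which is at the same time a threshold for the
gauge of a variable beyond which an eventually constant formula is constant. -/
noncomputable def weight : ∀ {n : ℕ}, PreFormula S n → ℝ≥0
  | _, rel _ _ => 0
  | _, dist _ _ => 0
  | _, gauge _ => 0
  | _, one => 1
  -- Not halved: halving the values leaves the threshold where it was.
  | _, half φ => φ.weight
  | _, add φ ψ => φ.weight + ψ.weight
  -- As a bound, `φ.weight` would do; the second summand makes the sum a threshold for ψ as well.
  | _, dotminus φ ψ => φ.weight + ψ.weight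
  | _, sup φ => φ.weight
  | _, inf φ => φ.weight

end PreFormula

theorem evalPart_le_weight : ∀ {n : ℕ} {φ : PreFormula S n}, φ.IsBounded →
    ∀ a : Fin n → Option M, evalPart φ a ≤ φ.weight
  | _, .rel _ _, h, _ => h.elim
  | _, .dist _ _, h, _ => h.elim
  | _, .gauge _, h, _ => h.elim
  | _, .one, _, _ => by simp [evalPart, PreFormula.weight]
  | _, .half φ, h, a => by
      rw [evalPart, PreFormula.weight]
      exact ENNReal.half_le_self.trans (evalPart_le_weight (φ := φ) h a)
  | _, .add φ ψ, h, a => by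
      rw [evalPart, PreFormula.weight, ENNReal.coe_add]
      exact add_le_add (evalPart_le_weight h.1 a) (evalPart_le_weight h.2 a)
  | _, .dotminus φ ψ, h, a => by
      rw [evalPart, PreFormula.weight, ENNReal.coe_add]
      exact tsub_le_self.trans ((evalPart_le_weight (φ := φ) h a).trans le_self_add)
  | _, .sup φ, h, a => by
      rw [evalPart, PreFormula.weight]
      exact iSup_le fun b => evalPart_le_weight (φ := φ) h _
  | _, .inf φ, h, a => by
      rw [evalPart, PreFormula.weight]
      exact (iInf_le _ none).trans (evalPart_le_weight (φ := φ) h _)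

theorem termPart_update {n : ℕ} {k : Fin n} {t : S.toLanguage.Term (Fin n)} (h : k ∉ t.varFinset)
    (a : Fin n → Option M) (b : Option M) : termPart a t = termPart (Function.update a k b) t :=
  termPart_congr fun j hj => by
    rw [Function.update_of_ne]
    rintro rfl
    exact h hj

/-- Beyond the threshold `φ.weight`, a formula which is eventually constant in a variable takes its
value at infinity. -/
theorem evalPart_update_none : ∀ {n : ℕ} {φ : PreFormula S n} {k : Fin n}, φ.EventuallyConst k →
    ∀ {a : Fin n → Option M} {b : M}, a k = some b → φ.weight ≤ PreStructure.gauge S b →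
      evalPart φ a = evalPart φ (Function.update a k none)
  | _, .rel R ts, k, h, a, b, _, _ => by
      rw [evalPart, evalPart]
      exact atomPart_congr fun i => termPart_update (h i) _ _
  | _, .dist s t, k, h, a, b, _, _ => by
      rw [evalPart, evalPart]
      refine atomPart_congr fun i => ?_
      fin_cases i
      exacts [termPart_update h.1 _ _, termPart_update h.2 _ _]
  | _, .gauge t, k, h, a, b, _, _ => by
      rw [evalPart, evalPart]
      refine atomPart_congr fun i => ?_
      fin_cases i
      exact termPart_update h _ _
  | _, .one, _, _, _, _, _, _ => by simp [evalPart]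
  | _, .half φ, k, h, a, b, ha, hb => by
      rw [evalPart, evalPart, evalPart_update_none (φ := φ) h ha hb]
  | _, .add φ ψ, k, h, a, b, ha, hb => by
      rw [evalPart, evalPart, evalPart_update_none (φ := φ) h.1 ha (le_self_add.trans hb),
        evalPart_update_none (φ := ψ) h.2 ha (le_add_self.trans hb)]
  | _, .dotminus φ ψ, k, h, a, b, ha, hb => by
      rw [evalPart, evalPart]
      rcases h with h | ⟨h, rfl⟩
      · rw [evalPart_update_none (φ := φ) h.1 ha (le_self_add.trans hb),
          evalPart_update_none (φ := ψ) h.2 ha (le_add_self.trans hb)]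
      -- The value at ∞ is 0. At b the difference also vanishes, because φ ≤ `φ.weight` ≤ ν(b).
      · rw [evalPart_gauge_var (Function.update_self ..), ENNReal.sub_top, tsub_eq_zero_iff_le]
        refine (evalPart_le_weight h a).trans ?_
        have : (seqTuple fun i => termPart a
            ((![FirstOrder.Language.Term.var k] : Fin 1 → S.toLanguage.Term _) i)) =
            some fun _ => b := by
          rw [seqTuple_eq_some_iff]
          intro i
          fin_cases i
          exact ha
        rw [evalPart, atomPart, this]
        exact ENNReal.coe_le_coe.2 (le_self_add.trans hb)
  | _, .sup φ, k, h, a, b, ha, hb => by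
      rw [evalPart, evalPart]
      refine iSup_congr fun c => ?_
      rw [Fin.snoc_update]
      exact evalPart_update_none (φ := φ) h (by simpa using ha) hb
  | _, .inf φ, k, h, a, b, ha, hb => by
      rw [evalPart, evalPart]
      refine iInf_congr fun c => ?_
      rw [Fin.snoc_update]
      exact evalPart_update_none (φ := φ) h (by simpa using ha) hb

theorem evalPart_snoc_some_eq {n : ℕ} {φ : PreFormula S (n + 1)}
    (h : φ.EventuallyConst (Fin.last n)) (a : Fin n → Option M) {b : M}
    (hb : φ.weight ≤ PreStructure.gauge S b) :
    evalPart φ (Fin.snoc (α := fun _ => Option M) a (some b)) =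
      evalPart φ (Fin.snoc (α := fun _ => Option M) a none) := by
  rw [evalPart_update_none h (a := Fin.snoc (α := fun _ => Option M) a (some b)) (by simp) hb,
    Fin.update_snoc_last]

end PartialSemantics

end UnboundedLogic

namespace UnboundedLogic

/-! ### Boundedness and uniform continuity on gauge balls -/

section UniformContinuity

/-- The modulus at 1/(R+1) governs all tuples of gauge at most R and gives a bound R' independent of
ε. This independence allows moduli to be composed. -/
theorem RespectsUnder.exists_bound_unif {X : Type*} {Y : Type*} [PseudoMetricSpace X]
    [PseudoMetricSpace Y] {ν : X → ℝ≥0} {νY : Y → ℝ≥0} {δ : ContinuityModulus} {n : ℕ}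
    {g : (Fin n → X) → Y} (hg : RespectsUnder (tupleGauge ν) νY δ g) (R : ℝ≥0) :
    ∃ R' : ℝ≥0, ∀ ε : ℝ, 0 < ε → ∃ η : ℝ, 0 < η ∧ ∀ a b : Fin n → X,
      (∀ i, ν (a i) ≤ R ∧ ν (b i) ≤ R ∧ dist (a i) (b i) < η) →
        νY (g a) ≤ R' ∧ νY (g b) ≤ R' ∧ dist (g a) (g b) < ε := by
  have hpos : (0 : ℝ) < 1 / (R + 1) := by positivity
  have key : ∀ {ε : ℝ}, 0 < ε → ε ≤ 1 / (R + 1) → ∀ a : Fin n → X, (∀ i, ν (a i) ≤ R) →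
      ((tupleGauge ν a : ℝ≥0) : ℝ) < 1 / ε := by
    intro ε hε hle a ha
    rw [tupleGauge_lt_iff hε]
    intro i
    have h1 : (ν (a i) : ℝ) ≤ R := by exact_mod_cast ha i
    have h2 : (R + 1 : ℝ) ≤ 1 / ε := by
      rw [le_div_iff₀ hε]
      calc (R + 1 : ℝ) * ε ≤ (R + 1) * (1 / (R + 1)) := by gcongr
        _ = 1 := by field_simp
    linarith
  refine ⟨(1 / δ (1 / (R + 1))).toNNReal, fun ε hε => ?_⟩
  -- The second entry keeps gauges up to R within the scope of the modulus; the first turns its weak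
  -- inequality into a strict one.
  have hε' : 0 < min (ε / 2) (1 / (R + 1) : ℝ) := lt_min (half_pos hε) hpos
  refine ⟨δ (min (ε / 2) (1 / (R + 1))), δ.pos _ hε', fun a b h => ⟨?_, ?_, ?_⟩⟩
  · exact NNReal.le_toNNReal_of_coe_le (hg.gauge_le hpos (key hpos le_rfl a fun i => (h i).1))
  · exact NNReal.le_toNNReal_of_coe_le (hg.gauge_le hpos (key hpos le_rfl b fun i => (h i).2.1))
  · have hd : dist a b < δ (min (ε / 2) (1 / (R + 1))) :=
      (dist_pi_lt_iff (δ.pos _ hε')).2 fun i => (h i).2.2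
    have := (hg _ hε' a b (key hε' (min_le_right _ _) a fun i => (h i).1)
      (key hε' (min_le_right _ _) b fun i => (h i).2.1) hd).1
    have h3 := min_le_left (ε / 2) (1 / (R + 1) : ℝ)
    linarith

variable {S : Signature.{u, v}}

/-- Two elements of `M ∪ {∞}` are both infinite, or have gauge at most `R` and distance less than
`δ`. -/
def CloseUnder (S : Signature.{u, v}) {M : Type w} [PseudoMetricSpace M] [PreStructure S M]
    (R : ℝ≥0) (δ : ℝ) : Option M → Option M → Prop :=
  Option.Rel fun x y => PreStructure.gauge S x ≤ R ∧ PreStructure.gauge S y ≤ R ∧ dist x y < δ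

variable {M : Type w} [PseudoMetricSpace M] [PreStructure S M]

theorem CloseUnder.symm {R : ℝ≥0} {δ : ℝ} {x y : Option M} (h : CloseUnder S R δ x y) :
    CloseUnder S R δ y x := by
  cases h with
  | none => exact .none
  | some h => exact .some ⟨h.2.1, h.1, (dist_comm _ _).trans_lt h.2.2⟩

theorem CloseUnder.mono {R R' : ℝ≥0} (hR : R ≤ R') {δ δ' : ℝ} (hδ : δ ≤ δ') {x y : Option M}
    (h : CloseUnder S R δ x y) : CloseUnder S R' δ' x y := by
  cases h with
  | none => exact .none
  | some h => exact .some ⟨h.1.trans hR, h.2.1.trans hR, h.2.2.trans_le hδ⟩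

theorem CloseUnder.eq_none {R : ℝ≥0} {δ : ℝ} {x y : Option M} (h : CloseUnder S R δ x y)
    (hy : y = none) : x = none := by
  cases h with
  | none => rfl
  | some h => cases hy

theorem closeUnder_refl {R : ℝ≥0} {δ : ℝ} (hδ : 0 < δ) {x : Option M}
    (h : ∀ b, x = some b → PreStructure.gauge S b ≤ R) : CloseUnder S R δ x x := by
  cases x with
  | none => exact .none
  | some b => exact .some ⟨h b rfl, h b rfl, by simpa using hδ⟩

theorem CloseUnder.seqTuple {R : ℝ≥0} {δ : ℝ} {k : ℕ} {y y' : Fin k → Option M}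
    (h : ∀ i, CloseUnder S R δ (y i) (y' i)) :
    Option.Rel (fun c c' : Fin k → M => ∀ i, PreStructure.gauge S (c i) ≤ R ∧
      PreStructure.gauge S (c' i) ≤ R ∧ dist (c i) (c' i) < δ) (seqTuple y) (seqTuple y') := by
  by_cases hy : ∀ i, y i ≠ none
  · obtain ⟨c, hc⟩ := exists_seqTuple_eq_some hy
    obtain ⟨c', hc'⟩ := exists_seqTuple_eq_some fun i hi => hy i ((h i).eq_none hi)
    rw [hc, hc']
    refine .some fun i => ?_
    have := h i
    rw [seqTuple_eq_some_iff.1 hc i, seqTuple_eq_some_iff.1 hc' i] at this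
    cases this with
    | some h => exact h
  · push Not at hy
    obtain ⟨i, hi⟩ := hy
    have hi' : y' i = none := (h i).symm.eq_none hi
    have h1 : ∀ {z : Fin k → Option M}, z i = none → UnboundedLogic.seqTuple z = none := by
      intro z hz
      by_contra hne
      obtain ⟨c, hc⟩ := Option.ne_none_iff_exists'.1 hne
      simp [seqTuple_eq_some_iff.1 hc i] at hz
    rw [h1 hi, h1 hi']
    exact .none

/-- Handles the finitely many arguments of a symbol at once: take the largest R, and intersect the
sets of admissible δ. -/
theorem exists_forall_closeUnder {ι : Type*} [Fintype ι] {F : ι → ℝ≥0 → ℝ → ℝ → Prop}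
    (mono : ∀ i R R' ε δ, R ≤ R' → F i R ε δ → F i R' ε δ)
    (h : ∀ i, ∃ R, ∀ ε : ℝ, 0 < ε → ∀ᶠ δ in 𝓝[>] (0 : ℝ), F i R ε δ) :
    ∃ R, ∀ ε : ℝ, 0 < ε → ∀ᶠ δ in 𝓝[>] (0 : ℝ), ∀ i, F i R ε δ := by
  choose R hR using h
  refine ⟨Finset.univ.sup R, fun ε hε => eventually_all.2 fun i => ?_⟩
  filter_upwards [hR i ε hε] with δ hδ
  exact mono i _ _ _ _ (Finset.le_sup (Finset.mem_univ i)) hδ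

/-- Terms are bounded and uniformly continuous on sets of bounded gauge. -/
theorem termPart_closeUnder {n : ℕ} (R : ℝ≥0) : ∀ t : S.toLanguage.Term (Fin n),
    ∃ R' : ℝ≥0, ∀ ε : ℝ, 0 < ε → ∀ᶠ δ in 𝓝[>] (0 : ℝ), ∀ a a' : Fin n → Option M,
      (∀ j, CloseUnder S R δ (a j) (a' j)) →
        CloseUnder S R' ε (termPart a t) (termPart a' t)
  | .var j => by
      refine ⟨R, fun ε hε => ?_⟩
      filter_upwards [Ioo_mem_nhdsGT hε] with δ hδ a a' h
      exact (h j).mono le_rfl hδ.2.le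
  | .func f ts => by
      obtain ⟨R₁, h₁⟩ := exists_forall_closeUnder
        (F := fun i R' ε δ => ∀ a a' : Fin n → Option M, (∀ j, CloseUnder S R δ (a j) (a' j)) →
          CloseUnder S R' ε (termPart a (ts i)) (termPart a' (ts i)))
        (fun i R R' ε δ hle h a a' hc => (h a a' hc).mono hle le_rfl)
        fun i => termPart_closeUnder R (ts i)
      obtain ⟨R', h'⟩ := (PreStructure.func_respects (S := S) (M := M) f).exists_bound_unif R₁
      refine ⟨R', fun ε hε => ?_⟩
      obtain ⟨η, hη, h'⟩ := h' ε hε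
      filter_upwards [h₁ η hη] with δ hδ a a' h
      have := CloseUnder.seqTuple fun i => hδ i a a' h
      simp only [termPart]
      revert this
      generalize seqTuple (fun i => termPart a (ts i)) = y
      generalize seqTuple (fun i => termPart a' (ts i)) = y'
      intro this
      cases this with
      | none => exact .none
      | some h => exact .some (h' _ _ h)

/-- Infinite values are only assigned to variables in which the formula is eventually constant. -/
def Admissible {α : Type*} {n : ℕ} (φ : PreFormula S n) (a : Fin n → Option α) : Prop :=
  ∀ k, a k = none → φ.EventuallyConst k

/-- Admissibility need not pass to ψ when ψ is the gauge of a variable. It fails only if that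
variable is assigned ∞, and then the difference is 0 regardless of φ. -/
theorem Admissible.dotminus {α : Type*} {n : ℕ} {φ ψ : PreFormula S n} {a : Fin n → Option α}
    (h : Admissible (φ.dotminus ψ) a) : (Admissible φ a ∧ Admissible ψ a) ∨
      ∃ k, a k = none ∧ ψ = .gauge (FirstOrder.Language.Term.var k) := by
  by_cases hk : ∃ k, a k = none ∧ ψ = .gauge (FirstOrder.Language.Term.var k)
  · exact Or.inr hk
  · have := fun k hak => (h k hak).resolve_right fun h' => hk ⟨k, hak, h'.2⟩
    exact Or.inl ⟨fun k hak => (this k hak).1, fun k hak => (this k hak).2⟩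

theorem Admissible.snoc {α : Type*} {n : ℕ} {φ : PreFormula S (n + 1)} {a : Fin n → Option α}
    (h : ∀ k, a k = none → φ.EventuallyConst k.castSucc)
    (hφ : φ.EventuallyConst (Fin.last n)) (b : Option α) :
    Admissible φ (Fin.snoc (α := fun _ => Option α) a b) := by
  intro k
  induction k using Fin.lastCases with
  | last => exact fun _ => hφ
  | cast k => simpa using h k

theorem Admissible.exists_seqTuple {n k : ℕ} {a : Fin n → Option M}
    {ts : Fin k → S.toLanguage.Term (Fin n)} (h : ∀ j, a j = none → ∀ i, j ∉ (ts i).varFinset) :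
    ∃ c, UnboundedLogic.seqTuple (fun i => termPart a (ts i)) = some c :=
  exists_seqTuple_eq_some fun i => termPart_ne_none fun j hj => h j hj i

/-- The one-sided estimate suffices: closeness is symmetric and forces a and a' to be infinite at
the same variables. -/
theorem atomPart_unif {n k : ℕ} {g : (Fin k → M) → ℝ≥0} {m : ContinuityModulus}
    (hg : RespectsUnder (tupleGauge (PreStructure.gauge S)) id m g)
    (ts : Fin k → S.toLanguage.Term (Fin n)) (R : ℝ≥0) :
    ∃ B : ℝ≥0, ∀ ε : ℝ≥0, 0 < ε → ∀ᶠ δ in 𝓝[>] (0 : ℝ), ∀ a a' : Fin n → Option M,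
      (∀ j, a j = none → ∀ i, j ∉ (ts i).varFinset) → (∀ j, CloseUnder S R δ (a j) (a' j)) →
        atomPart g ts a ≤ B ∧ atomPart g ts a ≤ atomPart g ts a' + ε := by
  obtain ⟨R₁, h₁⟩ := exists_forall_closeUnder
    (F := fun i R' ε δ => ∀ a a' : Fin n → Option M, (∀ j, CloseUnder S R δ (a j) (a' j)) →
      CloseUnder S R' ε (termPart a (ts i)) (termPart a' (ts i)))
    (fun i R R' ε δ hle h a a' hc => (h a a' hc).mono hle le_rfl)
    fun i => termPart_closeUnder R (ts i)
  obtain ⟨B, hB⟩ := hg.exists_bound_unif R₁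
  refine ⟨B, fun ε hε => ?_⟩
  obtain ⟨η, hη, h'⟩ := hB ε hε
  filter_upwards [h₁ η hη] with δ hδ a a' ha h
  obtain ⟨c, hc⟩ := Admissible.exists_seqTuple ha
  have := CloseUnder.seqTuple fun i => hδ i a a' h
  simp only [atomPart]
  rw [hc] at this ⊢
  revert this
  generalize seqTuple (fun i => termPart a' (ts i)) = y'
  intro this
  cases this with
  | @some _ c' h =>
    obtain ⟨h1, -, h3⟩ := h' _ _ h
    simp only [Option.elim_some, id] at h1 ⊢
    refine ⟨by exact_mod_cast h1, ?_⟩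
    rw [NNReal.dist_eq] at h3
    have := (abs_lt.1 h3).2
    have h4 : (g c : ℝ) ≤ g c' + ε := by linarith
    exact_mod_cast h4

/-- Formulae are bounded and uniformly continuous on sets of bounded gauge. -/
theorem evalPart_unif : ∀ {n : ℕ} {φ : PreFormula S n}, φ.IsFormula → ∀ R : ℝ≥0,
    ∃ B : ℝ≥0, ∀ ε : ℝ≥0, 0 < ε → ∀ᶠ δ in 𝓝[>] (0 : ℝ), ∀ a a' : Fin n → Option M,
      Admissible φ a → (∀ j, CloseUnder S R δ (a j) (a' j)) →
        evalPart φ a ≤ B ∧ evalPart φ a ≤ evalPart φ a' + ε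
  | _, .rel r ts, _, R => by
      simp only [evalPart]
      exact atomPart_unif (PreStructure.rel_respects r) ts R
  | _, .dist s t, _, R => by
      obtain ⟨B, hB⟩ := atomPart_unif (PreStructure.dist_respects (S := S) (M := M)) ![s, t] R
      refine ⟨B, fun ε hε => ?_⟩
      filter_upwards [hB ε hε] with δ hδ a a' ha h
      simp only [evalPart]
      refine hδ a a' (fun j hj i => ?_) h
      fin_cases i
      exacts [(ha j hj).1, (ha j hj).2]
  | _, .gauge t, _, R => by
      obtain ⟨B, hB⟩ := atomPart_unif (PreStructure.gauge_respects (S := S) (M := M)) ![t] R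
      refine ⟨B, fun ε hε => ?_⟩
      filter_upwards [hB ε hε] with δ hδ a a' ha h
      simp only [evalPart]
      refine hδ a a' (fun j hj i => ?_) h
      fin_cases i
      exact ha j hj
  | _, .one, _, R => ⟨1, fun ε _ => Eventually.of_forall fun δ a a' _ _ => by simp [evalPart]⟩
  | _, .half φ, hφ, R => by
      obtain ⟨B, hB⟩ := evalPart_unif (φ := φ) hφ R
      refine ⟨B, fun ε hε => ?_⟩
      filter_upwards [hB ε hε] with δ hδ a a' ha h
      obtain ⟨h1, h2⟩ := hδ a a' ha h
      simp only [evalPart]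
      refine ⟨ENNReal.half_le_self.trans h1, ?_⟩
      calc evalPart φ a / 2 ≤ (evalPart φ a' + ε) / 2 := by gcongr
        _ = evalPart φ a' / 2 + ε / 2 := ENNReal.add_div
        _ ≤ evalPart φ a' / 2 + ε := by gcongr; exact ENNReal.half_le_self
  | _, .add φ ψ, hφ, R => by
      obtain ⟨B, hB⟩ := evalPart_unif hφ.1 R
      obtain ⟨C, hC⟩ := evalPart_unif hφ.2 R
      refine ⟨B + C, fun ε hε => ?_⟩
      filter_upwards [hB (ε / 2) (half_pos hε), hC (ε / 2) (half_pos hε)] with δ hδ hδ' a a' ha h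
      obtain ⟨h1, h2⟩ := hδ a a' (fun k hk => (ha k hk).1) h
      obtain ⟨h3, h4⟩ := hδ' a a' (fun k hk => (ha k hk).2) h
      simp only [evalPart]
      refine ⟨by rw [ENNReal.coe_add]; exact add_le_add h1 h3, (add_le_add h2 h4).trans_eq ?_⟩
      rw [add_add_add_comm, ← ENNReal.coe_add, add_halves]
  | _, .dotminus φ ψ, hφ, R => by
      obtain ⟨B, hB⟩ := evalPart_unif hφ.1 R
      obtain ⟨C, hC⟩ := evalPart_unif hφ.2 R
      refine ⟨B, fun ε hε => ?_⟩
      filter_upwards [hB (ε / 2) (half_pos hε), hC (ε / 2) (half_pos hε)] with δ hδ hδ' a a' ha h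
      simp only [evalPart]
      rcases ha.dotminus with ⟨hφ, hψ⟩ | ⟨k, hk, rfl⟩
      · obtain ⟨h1, h2⟩ := hδ a a' hφ h
        -- The difference is decreasing in ψ, so the estimate for ψ is needed with a and a'
        -- exchanged.
        obtain ⟨-, h4⟩ := hδ' a' a (fun k hk => hψ k ((h k).eq_none hk)) fun j => (h j).symm
        refine ⟨tsub_le_self.trans h1, ?_⟩
        rw [tsub_le_iff_right]
        calc evalPart φ a ≤ evalPart φ a' + (ε / 2 : ℝ≥0) := h2
          _ ≤ (evalPart φ a' - evalPart ψ a' + evalPart ψ a') + (ε / 2 : ℝ≥0) := by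
            gcongr
            exact le_tsub_add
          _ ≤ (evalPart φ a' - evalPart ψ a' + (evalPart ψ a + (ε / 2 : ℝ≥0))) +
              (ε / 2 : ℝ≥0) := by gcongr
          _ = evalPart φ a' - evalPart ψ a' + ((ε / 2 + ε / 2 : ℝ≥0) : ℝ≥0∞) + evalPart ψ a := by
            rw [ENNReal.coe_add]
            ring
          _ = _ := by rw [add_halves]
      · rw [evalPart_gauge_var hk]
        simp
  | _, .sup φ, hφ, R => by
      -- Values of the bound variable beyond the threshold can be replaced by ∞, so the induction
      -- hypothesis is needed only on this larger ball.
      obtain ⟨B, hB⟩ := evalPart_unif hφ.1 (max R φ.weight)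
      refine ⟨B, fun ε hε => ?_⟩
      filter_upwards [hB ε hε, self_mem_nhdsWithin] with δ hδ hpos a a' ha h
      have key : ∀ b : Option M, evalPart φ (Fin.snoc (α := fun _ => Option M) a b) ≤ B ∧
          evalPart φ (Fin.snoc (α := fun _ => Option M) a b) ≤
            (⨆ b : Option M, evalPart φ (Fin.snoc (α := fun _ => Option M) a' b)) + ε := by
        have aux : ∀ b : Option M, CloseUnder S (max R φ.weight) δ b b →
            evalPart φ (Fin.snoc (α := fun _ => Option M) a b) ≤ B ∧
            evalPart φ (Fin.snoc (α := fun _ => Option M) a b) ≤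
            (⨆ b : Option M, evalPart φ (Fin.snoc (α := fun _ => Option M) a' b)) + ε := by
          intro b hb
          obtain ⟨h1, h2⟩ := hδ (Fin.snoc (α := fun _ => Option M) a b)
            (Fin.snoc (α := fun _ => Option M) a' b) (Admissible.snoc ha hφ.2 b) (by
              intro j
              induction j using Fin.lastCases with
              | last => simpa using hb
              | cast j => simpa using (h j).mono (le_max_left _ _) le_rfl)
          refine ⟨h1, h2.trans ?_⟩
          gcongr
          exact le_iSup
            (fun b : Option M => evalPart φ (Fin.snoc (α := fun _ => Option M) a' b)) b
        intro b
        cases b with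
        | none => exact aux none .none
        | some b =>
          rcases le_total φ.weight (PreStructure.gauge S b) with hb | hb
          · rw [evalPart_snoc_some_eq hφ.2 a hb]
            exact aux none .none
          · exact aux _ (closeUnder_refl hpos fun _ e => by
              cases e
              exact hb.trans (le_max_right _ _))
      simp only [evalPart]
      exact ⟨iSup_le fun b => (key b).1, iSup_le fun b => (key b).2⟩
  | _, .inf φ, hφ, R => by
      obtain ⟨B, hB⟩ := evalPart_unif hφ.1 (max R φ.weight)
      refine ⟨B, fun ε hε => ?_⟩
      filter_upwards [hB ε hε, self_mem_nhdsWithin] with δ hδ hpos a a' ha h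
      have aux : ∀ b : Option M, CloseUnder S (max R φ.weight) δ b b →
          evalPart φ (Fin.snoc (α := fun _ => Option M) a b) ≤ B ∧
          evalPart φ (Fin.snoc (α := fun _ => Option M) a b) ≤
            evalPart φ (Fin.snoc (α := fun _ => Option M) a' b) + ε := by
        intro b hb
        refine hδ (Fin.snoc (α := fun _ => Option M) a b)
          (Fin.snoc (α := fun _ => Option M) a' b) (Admissible.snoc ha hφ.2 b) fun j => ?_
        induction j using Fin.lastCases with
        | last => simpa using hb
        | cast j => simpa using (h j).mono (le_max_left _ _) le_rfl
      simp only [evalPart]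
      -- The point ∞ bounds the infimum even when M is empty.
      refine ⟨(iInf_le _ none).trans (aux none .none).1, ?_⟩
      rw [ENNReal.iInf_add]
      refine le_iInf fun b => ?_
      cases b with
      | none => exact (iInf_le _ none).trans (aux none .none).2
      | some b =>
        rcases le_total φ.weight (PreStructure.gauge S b) with hb | hb
        -- For an infimum it is the competitor on the side of a' that is moved to ∞.
        · rw [evalPart_snoc_some_eq hφ.2 a' hb]
          exact (iInf_le _ none).trans (aux none .none).2
        · exact (iInf_le _ (some b)).trans (aux _ (closeUnder_refl hpos fun _ e => by
            cases e
            exact hb.trans (le_max_right _ _))).2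

theorem exists_gauge_bound (S : Signature.{u, v}) {M : Type w} [PseudoMetricSpace M]
    [PreStructure S M] {n : ℕ} (a : Fin n → Option M) :
    ∃ R : ℝ≥0, ∀ j b, a j = some b → PreStructure.gauge S b ≤ R := by
  refine ⟨Finset.univ.sup fun j => (a j).elim 0 (PreStructure.gauge S), fun j b hb => ?_⟩
  have := Finset.le_sup (f := fun j => (a j).elim 0 (PreStructure.gauge S)) (Finset.mem_univ j)
  simpa [hb] using this

/-- An assignment is close to itself, so the uniform bound on a gauge ball containing its finite
values applies. -/
theorem evalPart_ne_top {n : ℕ} {φ : PreFormula S n} (hφ : φ.IsFormula) {a : Fin n → Option M}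
    (ha : Admissible φ a) : evalPart φ a ≠ ⊤ := by
  obtain ⟨R, hR⟩ := exists_gauge_bound S a
  obtain ⟨B, hB⟩ := evalPart_unif (M := M) hφ R
  obtain ⟨δ, hδ, hpos⟩ := ((hB 1 one_pos).and self_mem_nhdsWithin).exists
  exact ne_top_of_le_ne_top ENNReal.coe_ne_top
    (hδ a a ha fun j => closeUnder_refl hpos (hR j)).1

theorem continuous_evalPart_snoc {n : ℕ} {φ : PreFormula S (n + 1)} (hφ : φ.IsFormula)
    {a : Fin n → Option M} (h : ∀ b, Admissible φ (Fin.snoc (α := fun _ => Option M) a b)) :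
    Continuous fun b : M => evalPart φ (Fin.snoc (α := fun _ => Option M) a (some b)) := by
  rw [continuous_iff_continuousAt]
  intro b
  rw [ContinuousAt, ENNReal.tendsto_nhds (evalPart_ne_top hφ (h _))]
  intro ε hε
  obtain ⟨ε', hε', hle⟩ : ∃ ε' : ℝ≥0, 0 < ε' ∧ (ε' : ℝ≥0∞) ≤ ε := by
    obtain ⟨ε', h1, h2⟩ := ENNReal.lt_iff_exists_nnreal_btwn.1 hε
    exact ⟨ε', by exact_mod_cast h1, h2.le⟩
  obtain ⟨R, hR⟩ := exists_gauge_bound S a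
  -- The margin 1 puts a whole neighbourhood of b inside the gauge ball.
  obtain ⟨B, hB⟩ := evalPart_unif (M := M) hφ (max R (PreStructure.gauge S b + 1))
  obtain ⟨δ, hδ, hpos⟩ := ((hB ε' hε').and self_mem_nhdsWithin).exists
  have hν : ∀ᶠ c in 𝓝 b, PreStructure.gauge S c < PreStructure.gauge S b + 1 :=
    (PreStructure.gauge_lipschitz (S := S) (M := M)).continuous.continuousAt.eventually_lt_const
      (lt_add_one _)
  filter_upwards [Metric.ball_mem_nhds b hpos, hν] with c hc hc'
  have hclose : ∀ j, CloseUnder S (max R (PreStructure.gauge S b + 1)) δ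
      (Fin.snoc (α := fun _ => Option M) a (some c) j)
      (Fin.snoc (α := fun _ => Option M) a (some b) j) := by
    intro j
    induction j using Fin.lastCases with
    | last =>
      simp only [Fin.snoc_last]
      exact .some ⟨hc'.le.trans (le_max_right _ _), le_self_add.trans (le_max_right _ _), hc⟩
    | cast j =>
      simp only [Fin.snoc_castSucc]
      exact closeUnder_refl hpos fun x hx => (hR j x hx).trans (le_max_left _ _)
  constructor
  · rw [tsub_le_iff_right]
    exact (hδ _ _ (h _) fun j => (hclose j).symm).2.trans (by gcongr)
  · exact (hδ _ _ (h _) hclose).2.trans (by gcongr)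

end UniformContinuity

end UnboundedLogic

namespace UnboundedLogic

/-! ### Atomic values in the completion -/

section CompletionValues

variable {S : Signature.{u, v}} {X : Type w} [PseudoMetricSpace X] [PreStructure S X]

theorem func_coe {k : ℕ} (f : S.Functions k) (c : Fin k → X) :
    PreStructure.func (S := S) f (fun i => (c i : Completion X)) =
      ((PreStructure.func (S := S) f c : X) : Completion X) :=
  extendTuple_coe PreStructure.gauge_lipschitz
    (respects_coe_comp PreStructure.gauge_lipschitz (PreStructure.func_respects f)) c

theorem rel_coe {k : ℕ} (R : S.Relations k) (c : Fin k → X) :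
    PreStructure.rel (S := S) R (fun i => (c i : Completion X)) = PreStructure.rel (S := S) R c :=
  extendTuple_coe PreStructure.gauge_lipschitz (PreStructure.rel_respects R) c

theorem gauge_coe (c : X) :
    PreStructure.gauge S (c : Completion X) = PreStructure.gauge S c :=
  extendGauge_coe PreStructure.gauge_lipschitz c

theorem nndist_coe {X : Type*} [PseudoMetricSpace X] (c d : X) : nndist (c : Completion X) (d : Completion X) = nndist c d := by
  simp [nndist_dist]

theorem termPart_coe {n : ℕ} {a : Fin n → Option X} : ∀ {t : S.toLanguage.Term (Fin n)} {c : X},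
    termPart a t = some c →
      termPart (fun j => (a j).map ((↑) : X → Completion X)) t = some (c : Completion X)
  | .var j, c, h => by
      have h : a j = some c := h
      simp [termPart, h]
  | .func f ts, c, h => by
      rw [termPart, Option.map_eq_some_iff] at h
      obtain ⟨d, hd, rfl⟩ := h
      rw [seqTuple_eq_some_iff] at hd
      rw [termPart, seqTuple_eq_some_iff.2 fun i => termPart_coe (hd i), Option.map_some, func_coe]

theorem atomPart_coe {n k : ℕ} {a : Fin n → Option X} {g : (Fin k → X) → ℝ≥0}
    {G : (Fin k → Completion X) → ℝ≥0} (hG : ∀ c : Fin k → X, G (fun i => (c i)) = g c)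
    {ts : Fin k → S.toLanguage.Term (Fin n)}
    (h : ∀ j, a j = none → ∀ i, j ∉ (ts i).varFinset) :
    atomPart G ts (fun j => (a j).map ((↑) : X → Completion X)) = atomPart g ts a := by
  obtain ⟨c, hc⟩ := Admissible.exists_seqTuple h
  have hc' := seqTuple_eq_some_iff.1 hc
  rw [atomPart, atomPart, hc, seqTuple_eq_some_iff.2 fun i => termPart_coe (hc' i)]
  simp [hG]

end CompletionValues

/-! ### Łoś's theorem for partial assignments -/

section Los

variable {S : Signature.{u, v}} {I : Type x} {M : I → Type w} [∀ i, PseudoMetricSpace (M i)]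
  [∀ i, PreStructure S (M i)] {U : Ultrafilter I}

open Classical in
/-- The `i`-th coordinate of an element of `N₀ ∪ {∞}`. -/
noncomputable def coordPart (x : Option (PreUltraproduct S M U)) (i : I) : Option (M i) :=
  x.bind fun x => if h : Nonempty (M i) then some (x.1 i h) else none

@[simp]
theorem coordPart_none (i : I) : coordPart (none : Option (PreUltraproduct S M U)) i = none := rfl

theorem coordPart_some (x : PreUltraproduct S M U) {i : I} (h : Nonempty (M i)) :
    coordPart (some x) i = some (x.1 i h) := by
  simp [coordPart, h]

theorem termPart_coordPart {n : ℕ} {a : Fin n → Option (PreUltraproduct S M U)} {i : I}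
    (hi : Nonempty (M i)) : ∀ {t : S.toLanguage.Term (Fin n)} {c : PreUltraproduct S M U},
    termPart a t = some c → termPart (fun j => coordPart (a j) i) t = some (c.1 i hi)
  | .var j, c, h => by
      have h : a j = some c := h
      simp [termPart, h, coordPart_some c hi]
  | .func f ts, c, h => by
      rw [termPart, Option.map_eq_some_iff] at h
      obtain ⟨d, hd, rfl⟩ := h
      rw [seqTuple_eq_some_iff] at hd
      rw [termPart, seqTuple_eq_some_iff.2 fun l => termPart_coordPart hi (hd l), Option.map_some]
      rfl

/-- Terms act coordinatewise on N₀ and predicates there are ultralimits by definition; the passage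
to the completion is left to `atomPart_coe`. -/
theorem tendsto_atomPart {n k : ℕ} {a : Fin n → Option (PreUltraproduct S M U)}
    {g : ∀ i, (Fin k → M i) → ℝ≥0} {m : ContinuityModulus}
    (hg : ∀ i, RespectsUnder (tupleGauge (PreStructure.gauge S)) id m (g i))
    {ts : Fin k → S.toLanguage.Term (Fin n)}
    (h : ∀ j, a j = none → ∀ i, j ∉ (ts i).varFinset) :
    Tendsto (fun i => atomPart (g i) ts fun j => coordPart (a j) i) U
      (𝓝 (atomPart (ultraLimit g) ts a)) := by
  obtain ⟨c, hc⟩ := Admissible.exists_seqTuple h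
  have hc' := seqTuple_eq_some_iff.1 hc
  rw [atomPart, hc, Option.elim_some]
  refine (ENNReal.tendsto_coe.2 (tendsto_ultraLimit hg c)).congr' ?_
  filter_upwards [PreUltraproduct.eventually_nonempty c] with i hi
  rw [atomPart, seqTuple_eq_some_iff.2 fun l => termPart_coordPart (hi.map fun d => d l) (hc' l),
    coordValue, dif_pos hi]
  rfl

theorem ultraLimit_gauge :
    (fun c : Fin 1 → PreUltraproduct S M U => PreStructure.gauge S (c 0)) =
      ultraLimit fun i (c : Fin 1 → M i) => PreStructure.gauge S (c 0) := by
  funext c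
  change ultraLimit _ ![c 0] = _
  congr 1
  funext l
  fin_cases l
  rfl

theorem ultraLimit_dist :
    (fun c : Fin 2 → PreUltraproduct S M U => nndist (c 0) (c 1)) =
      ultraLimit fun i (c : Fin 2 → M i) => nndist (c 0) (c 1) := by
  funext c
  change ultraLimit _ ![c 0, c 1] = _
  congr 1
  funext l
  fin_cases l <;> rfl

theorem coordPart_snoc {n : ℕ} (a : Fin n → Option (PreUltraproduct S M U))
    (b : Option (PreUltraproduct S M U)) (i : I) :
    (fun j => coordPart (Fin.snoc (α := fun _ => Option (PreUltraproduct S M U)) a b j) i) =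
      Fin.snoc (α := fun _ => Option (M i)) (fun j => coordPart (a j) i) (coordPart b i) := by
  funext j
  induction j using Fin.lastCases <;> simp

theorem map_snoc {α β : Type*} (f : α → β) {n : ℕ} (a : Fin n → Option α) (b : Option α) :
    (fun j => (Fin.snoc (α := fun _ => Option α) a b j).map f) =
      Fin.snoc (α := fun _ => Option β) (fun j => (a j).map f) (b.map f) := by
  funext j
  induction j using Fin.lastCases <;> simp

/-- The saturation step: witnesses chosen coordinate by coordinate form an element of N₀ because
their gauges have a common bound. -/
theorem exists_preUltraproduct {p : ∀ i, M i → Prop} (C : ℝ≥0)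
    (h : ∀ᶠ i in (U : Filter I), ∃ b, PreStructure.gauge S b ≤ C ∧ p i b) :
    ∃ b : PreUltraproduct S M U, ∀ᶠ i in (U : Filter I), ∃ c, coordPart (some b) i = some c ∧
      p i c := by
  classical
  refine ⟨⟨fun i hi => if hb : ∃ b, PreStructure.gauge S b ≤ C ∧ p i b then hb.choose
    else hi.some, C, ?_⟩, ?_⟩
  · filter_upwards [h] with i hi
    refine ⟨⟨hi.choose⟩, ?_⟩
    rw [dif_pos hi]
    exact hi.choose_spec.1
  · filter_upwards [h] with i hi
    refine ⟨hi.choose, ?_, hi.choose_spec.2⟩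
    refine (coordPart_some _ ⟨hi.choose⟩).trans (congrArg some ?_)
    exact dif_pos hi

/-- Suprema over `Mᵢ ∪ {∞}` converge to the supremum over the ultraproduct and `∞`, provided that
the functions are eventually constant with a uniform threshold. -/
theorem tendsto_iSup_ultraproduct {α : Type*} [CompleteLinearOrder α] [DenselyOrdered α]
    [TopologicalSpace α] [OrderTopology α] {F : ∀ i, Option (M i) → α}
    {G : Option (Ultraproduct S M U) → α} (C : ℝ≥0)
    (hF : ∀ i (b : M i), C ≤ PreStructure.gauge S b → F i (some b) = F i none)
    (hG : Continuous fun b => G (some b))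
    (h : ∀ b : Option (PreUltraproduct S M U),
      Tendsto (fun i => F i (coordPart b i)) U (𝓝 (G (b.map Ultraproduct.mk)))) :
    Tendsto (fun i => ⨆ b, F i b) U (𝓝 (⨆ b, G b)) := by
  rw [tendsto_order]
  constructor
  · intro c hc
    obtain ⟨b, hb⟩ := lt_iSup_iff.1 hc
    obtain ⟨b', hb'⟩ : ∃ b' : Option (PreUltraproduct S M U), c < G (b'.map Ultraproduct.mk) := by
      cases b with
      | none => exact ⟨none, hb⟩
      | some b =>
        -- A point of the completion need not come from N₀, but the set where G exceeds c is open.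
        obtain ⟨b', hb'⟩ := Completion.denseRange_coe.exists_mem_open
          (isOpen_Ioi.preimage hG : IsOpen ((fun b => G (some b)) ⁻¹' Set.Ioi c)) ⟨b, hb⟩
        exact ⟨some b', hb'⟩
    filter_upwards [(h b').eventually_const_lt hb'] with i hi
    exact hi.trans_le (le_iSup (F i) _)
  · intro c hc
    -- Limits preserve only weak inequalities; the intermediate c' leaves room for a contradiction.
    obtain ⟨c', hc', hc'c⟩ := exists_between hc
    by_contra hne
    rw [← Ultrafilter.eventually_not] at hne
    have hlarge : ∀ᶠ i in (U : Filter I), c' < F i none ∨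
        ∃ b : M i, PreStructure.gauge S b ≤ C ∧ c' < F i (some b) := by
      filter_upwards [hne] with i hi
      obtain ⟨b, hb⟩ := lt_iSup_iff.1 (hc'c.trans_le (not_lt.1 hi))
      cases b with
      | none => exact Or.inl hb
      | some b =>
        rcases le_total C (PreStructure.gauge S b) with hCb | hCb
        -- A witness beyond the threshold is replaced by ∞, so the remaining witnesses have gauge at
        -- most C.
        · exact Or.inl (hF i b hCb ▸ hb)
        · exact Or.inr ⟨b, hCb, hb⟩
    obtain ⟨b, hb⟩ : ∃ b : Option (PreUltraproduct S M U),
        ∀ᶠ i in (U : Filter I), c' < F i (coordPart b i) := by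
      -- The ultrafilter decides whether the witness is ∞ or a family of bounded gauge.
      rcases Ultrafilter.eventually_or.1 hlarge with hl | hl
      · exact ⟨none, hl⟩
      · obtain ⟨b, hb⟩ := exists_preUltraproduct (p := fun i b => c' < F i (some b)) C hl
        refine ⟨some b, hb.mono ?_⟩
        rintro i ⟨d, hd, hlt⟩
        rwa [hd]
    have := ge_of_tendsto (h b) (hb.mono fun _ => le_of_lt)
    exact (this.trans (le_iSup G _)).not_gt hc'

/-- Łoś's theorem for partial assignments. -/
theorem tendsto_evalPart : ∀ {n : ℕ} {φ : PreFormula S n}, φ.IsFormula →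
    ∀ {a : Fin n → Option (PreUltraproduct S M U)}, Admissible φ a →
      Tendsto (fun i => evalPart φ fun j => coordPart (a j) i) U
        (𝓝 (evalPart φ fun j => (a j).map (Ultraproduct.mk (U := U))))
  | _, .rel R ts, _, a, ha => by
      simp only [evalPart]
      have := tendsto_atomPart (fun i => PreStructure.rel_respects (S := S) (M := M i) R) ha
      exact le_trans this (congrArg 𝓝
        (atomPart_coe (G := PreStructure.rel (S := S) R) (fun c => rel_coe R c) ha).symm).le
  | _, .dist s t, _, a, ha => by
      simp only [evalPart]
      have ha' : ∀ j, a j = none → ∀ i, j ∉ ((![s, t] : Fin 2 → S.toLanguage.Term _) i).varFinset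
        := by
        intro j hj i
        fin_cases i
        exacts [(ha j hj).1, (ha j hj).2]
      have := tendsto_atomPart (fun i => PreStructure.dist_respects (S := S) (M := M i)) ha'
      rw [← ultraLimit_dist] at this
      exact le_trans this (congrArg 𝓝 (atomPart_coe (g := fun c => nndist (c 0) (c 1))
        (G := fun c => nndist (c 0) (c 1)) (fun c => nndist_coe (c 0) (c 1)) ha').symm).le
  | _, .gauge t, _, a, ha => by
      simp only [evalPart]
      have ha' : ∀ j, a j = none → ∀ i, j ∉ ((![t] : Fin 1 → S.toLanguage.Term _) i).varFinset
        := by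
        intro j hj i
        fin_cases i
        exact ha j hj
      have := tendsto_atomPart (fun i => PreStructure.gauge_respects (S := S) (M := M i)) ha'
      rw [← ultraLimit_gauge] at this
      exact le_trans this (congrArg 𝓝 (atomPart_coe (G := fun c => PreStructure.gauge S (c 0))
        (fun c => gauge_coe (c 0)) ha').symm).le
  | _, .one, _, _, _ => by
      simp only [evalPart]
      exact tendsto_const_nhds
  | _, .half φ, hφ, a, ha => by
      simp only [evalPart]
      exact ENNReal.Tendsto.div_const (tendsto_evalPart (φ := φ) hφ ha) (Or.inr (by simp))
  | _, .add φ ψ, hφ, a, ha => by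
      simp only [evalPart]
      exact (tendsto_evalPart hφ.1 fun k hk => (ha k hk).1).add
        (tendsto_evalPart hφ.2 fun k hk => (ha k hk).2)
  | _, .dotminus φ ψ, hφ, a, ha => by
      simp only [evalPart]
      rcases ha.dotminus with ⟨hφ', hψ'⟩ | ⟨k, hk, rfl⟩
      -- Subtraction on [0,∞] is discontinuous at (∞,∞), whence the appeal to finiteness of φ.
      · refine ENNReal.Tendsto.sub (tendsto_evalPart hφ.1 hφ') (tendsto_evalPart hφ.2 hψ')
          (Or.inl (evalPart_ne_top hφ.1 fun k hk => hφ' k ?_))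
        simpa using hk
      -- Here ψ is ν(∞), so both the coordinate values and the limit are 0.
      · rw [evalPart_gauge_var (by simp [hk])]
        simp only [ENNReal.sub_top]
        refine tendsto_const_nhds.congr fun i => ?_
        rw [evalPart_gauge_var (by simp [hk]), ENNReal.sub_top]
  | _, .sup φ, hφ, a, ha => by
      simp only [evalPart]
      refine tendsto_iSup_ultraproduct φ.weight (fun i b hb => evalPart_snoc_some_eq hφ.2 _ hb)
        (continuous_evalPart_snoc hφ.1 fun b => Admissible.snoc (fun k hk => ha k ?_) hφ.2 b)
        fun b => ?_
      · simpa using hk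
      · have := tendsto_evalPart hφ.1 (Admissible.snoc ha hφ.2 b)
        simp only [coordPart_snoc, map_snoc] at this
        exact this
  | _, .inf φ, hφ, a, ha => by
      simp only [evalPart]
      -- Infima are suprema in the order dual, whose topology is the same.
      refine tendsto_iSup_ultraproduct (α := ℝ≥0∞ᵒᵈ) φ.weight
        (fun i b hb => evalPart_snoc_some_eq hφ.2 _ hb)
        (continuous_evalPart_snoc hφ.1 fun b => Admissible.snoc (fun k hk => ha k ?_) hφ.2 b)
        fun b => ?_
      · simpa using hk
      · have := tendsto_evalPart hφ.1 (Admissible.snoc ha hφ.2 b)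
        simp only [coordPart_snoc, map_snoc] at this
        exact this

theorem eval_ne_top {M : Type w} [PseudoMetricSpace M] [PreStructure S M] {n : ℕ}
    {φ : PreFormula S n} (hφ : φ.IsFormula) (a : Fin n → M) : eval φ a ≠ ⊤ := by
  rw [eval_eq_evalPart hφ]
  exact evalPart_ne_top hφ fun k hk => by simp at hk

end Los

end UnboundedLogic

/-! ### Łoś's theorem -/

theorem mainTheorem3 {S : UnboundedLogic.Signature.{u, v}} {I : Type x} (M : I → Type w)
    [∀ i, MetricSpace (M i)] [∀ i, CompleteSpace (M i)]
    [∀ i, UnboundedLogic.PreStructure S (M i)] (U : Ultrafilter I)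
    {n : ℕ} (φ : UnboundedLogic.PreFormula S n) (hφ : φ.IsFormula)
    (a : Fin n → UnboundedLogic.PreUltraproduct S M U) :
    (∀ (i : I) (c : Fin n → M i), UnboundedLogic.eval φ c ≠ ∞) ∧
    UnboundedLogic.eval φ (fun j => UnboundedLogic.Ultraproduct.mk (a j)) ≠ ∞ ∧
    Tendsto
      (UnboundedLogic.coordValue (fun i (c : Fin n → M i) => UnboundedLogic.eval φ c) a)
      U (𝓝 (UnboundedLogic.eval φ (fun j => UnboundedLogic.Ultraproduct.mk (a j)))) := by
  refine ⟨fun i c => UnboundedLogic.eval_ne_top hφ c, UnboundedLogic.eval_ne_top hφ _, ?_⟩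
  rw [UnboundedLogic.eval_eq_evalPart hφ]
  have := UnboundedLogic.tendsto_evalPart hφ (a := fun j => some (a j)) fun k hk => by simp at hk
  refine this.congr' ?_
  -- The default value 0 in `coordValue` occurs only on a U-negligible set of indices.
  filter_upwards [UnboundedLogic.PreUltraproduct.eventually_nonempty a] with i hi
  rw [UnboundedLogic.coordValue, dif_pos hi, UnboundedLogic.eval_eq_evalPart hφ]
  congr 1
  funext j
  -- The index j makes Mᵢ nonempty; for n = 0 there is no j and Mᵢ may be empty.
  exact UnboundedLogic.coordPart_some (a j) (hi.map fun c => c j)
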